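/- Let $\mathbb{K}$ be $\mathbb{R}$ or $\mathbb{C}$, let $\phi=\phi(x_1,\ldots,x_N)$ be a symmetric function of $N$ variables in $\mathbb{K}$, with values in $\mathbb{K}$, write $\phi_i=\partial_i\phi=\partial\phi/\partial x_i$, and let $J\subseteq I\subseteq\{1,\ldots,N\}$ with $|J|=p\geq1$. For a point at which the coordinates $x_i$, $i\in I$, are pairwise distinct, put \[D_I\phi:=\sum_{i\in I}\frac{\phi_i}{\prod_{j\in I,\ j\neq i}(x_j-x_i)};\] at other points $D_I\phi$ is defined as the limit, if it exists, of these values as points with pairwise distinct coordinates $x_i$, $i\in I$, tend to the given point. Consider a point $x$ where $x_i=y$ for all $i\in J$, while the values $x_k$, $k\in I\setminus J$, are distinct from $y$ and from one another, and assume that $\phi$ is of class $C^p$ (over $\mathbb{K}$) near $x$. For $1\leq g\leq p$ and a partition $\sigma\vdash g$ with parts $h_1,\ldots,h_l$, where $l=l(\sigma)$, let $\partial_J^\sigma\phi$ be the value at $x$ of $\partial_{j_1}^{h_1}\cdots\partial_{j_l}^{h_l}\phi$ for distinct $j_1,\ldots,j_l\in J$; this value does not depend on the choice of $j_1,\ldots,j_l$.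 Set \[\partial_J^g\phi:=\sum_{\sigma\vdash g}(-1)^{g-l(\sigma)}\frac{g\cdot(l(\sigma)-1)!}{\prod_{h=1}^{g}h!^{m_h}m_h!}\,\partial_J^\sigma\phi,\] where $m_h$ is the multiplicity of $h$ in $\sigma$. For a finite set $K$ and an integer $\nu\geq0$ let $A_{K,\nu}$ be the set of tuples $(a,\vec b)$ of positive integers $a$ and $\vec b=(b_k)_{k\in K}$ with $a+\sum_{k\in K}b_k=|K|+\nu+1$. Then $D_I\phi$ exists at $x$ (that is, the limit exists), and \[D_I\phi=\sum_{k\in I\setminus J}\frac{\phi_k}{(y-x_k)^p\prod_{l\in I\setminus(J\cup\{k\})}(x_l-x_k)}+\sum_{(a,\vec b)\in A_{I\setminus J,p-1}}\frac{(-1)^{p-a}\,\partial_J^a\phi}{\prod_{k\in I\setminus J}(x_k-y)^{b_k}},\] where the derivatives on the right-hand side are evaluated at $x$. -/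

import Mathlib

open Finset Filter Topology

namespace SymmDeriv

noncomputable section

variable {𝕜 : Type*} [RCLike 𝕜] {N : ℕ}

/-- A function of `N` variables is symmetric if it is invariant under all permutations of them. -/
def IsSymmetricFun (φ : (Fin N → 𝕜) → 𝕜) : Prop :=
  ∀ (π : Equiv.Perm (Fin N)) (z : Fin N → 𝕜), φ (z ∘ π) = φ z

/-- The mixed partial derivative `∂_{i_1} ⋯ ∂_{i_g} φ` at the point `x`, where `i_1, …, i_g` are the
values of `i`. It is used at points near which `φ` is of class `C^g`. -/
def mixedPartial {g : ℕ} (i : Fin g → Fin N) (φ : (Fin N → 𝕜) → 𝕜) (x : Fin N → 𝕜) : 𝕜 :=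
  iteratedFDeriv 𝕜 g φ x (fun q => Pi.single (i q) 1)

/-- The first partial derivative `φ_i = ∂φ/∂x_i` at the point `x`. -/
def firstPartial (i : Fin N) (φ : (Fin N → 𝕜) → 𝕜) (x : Fin N → 𝕜) : 𝕜 :=
  fderiv 𝕜 φ x (Pi.single i 1)

/-- The value at `x` of `D_I φ = ∑_{i ∈ I} φ_i / ∏_{j ∈ I, j ≠ i} (x_j - x_i)`. This expression is
meaningful where the coordinates `x_i`, `i ∈ I`, are pairwise distinct; elsewhere `D_I φ` is
understood as the limit of its values at such points. -/
def diffOp (I : Finset (Fin N)) (φ : (Fin N → 𝕜) → 𝕜) (x : Fin N → 𝕜) : 𝕜 :=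
  ∑ i ∈ I, firstPartial i φ x / ∏ j ∈ I.erase i, (x j - x i)

/-- The points at which the coordinates with indices in `I` are pairwise distinct. -/
def distinctOn (𝕜 : Type*) {N : ℕ} (I : Finset (Fin N)) : Set (Fin N → 𝕜) :=
  {z | Set.InjOn z (I : Set (Fin N))}

/-- The list of indices `i_1, …, i_g` takes values in `J`, and the numbers of times with which the
indices occurring in it are repeated form the partition `σ` of `g`. Equivalently, the derivative
`∂_{i_1} ⋯ ∂_{i_g}` is `∏_{i ∈ J} ∂_i^{h_i}`, where the nonzero `h_i` are the parts of `σ`. -/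
def IsAssignment (J : Finset (Fin N)) {g : ℕ} (σ : g.Partition) (i : Fin g → Fin N) : Prop :=
  (∀ q, i q ∈ J) ∧
    (univ.image i).val.map (fun k => #{q : Fin g | i q = k}) = σ.parts

/-- Assignments exist as soon as `J` has at least `l(σ)` elements. -/
theorem exists_isAssignment (J : Finset (Fin N)) {g : ℕ} (σ : g.Partition)
    (h : σ.parts.card ≤ #J) : ∃ i : Fin g → Fin N, IsAssignment J σ i := by
  obtain ⟨L, hL⟩ : ∃ L : List ℕ, (L : Multiset ℕ) = σ.parts := Quot.exists_rep σ.parts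
  have hlen : L.length ≤ #J := by simpa [← hL] using h
  have hsum : ∑ q : Fin L.length, L.get q = g := by
    rw [← σ.parts_sum, ← hL, Multiset.sum_coe, ← Fin.sum_univ_getElem]; simp
  have hpos : ∀ q : Fin L.length, 0 < L.get q := fun q =>
    σ.parts_pos (by rw [← hL]; exact Multiset.mem_coe.2 (List.get_mem L q))
  let f : Fin L.length → Fin N := fun q => J.orderEmbOfFin rfl (Fin.castLE hlen q)
  have hf : Function.Injective f := fun a b hab => by simpa [f] using hab
  let e : (Σ q : Fin L.length, Fin (L.get q)) ≃ Fin g :=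
    finSigmaFinEquiv.trans (finCongr hsum)
  refine ⟨fun t => f (e.symm t).1, fun q => J.orderEmbOfFin_mem rfl _, ?_⟩
  have himg : (univ.image fun t => f (e.symm t).1) = univ.map ⟨f, hf⟩ := by
    ext k
    simp only [mem_image, mem_univ, true_and, Finset.mem_map, Function.Embedding.coeFn_mk]
    constructor
    · rintro ⟨t, rfl⟩; exact ⟨_, rfl⟩
    · rintro ⟨q, rfl⟩; exact ⟨e ⟨q, ⟨0, hpos q⟩⟩, by simp⟩
  have hfib : ∀ q : Fin L.length, #{t : Fin g | f (e.symm t).1 = f q} = L.get q := by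
    intro q
    have : ({t : Fin g | f (e.symm t).1 = f q} : Finset (Fin g)) =
        univ.map ((Function.Embedding.sigmaMk q).trans e.toEmbedding) := by
      ext t
      simp only [mem_filter, mem_univ, true_and, Finset.mem_map, hf.eq_iff]
      constructor
      · intro ht
        refine ⟨ht ▸ (e.symm t).2, ?_⟩
        subst ht
        simp
      · rintro ⟨a, rfl⟩; simp
    rw [this]; simp
  rw [himg, Finset.map_val, Multiset.map_map, ← hL]
  simp only [Function.comp_apply, Function.Embedding.coeFn_mk, hfib, Fin.univ_val_map,
    List.ofFn_get]

open Classical in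
/-- The derivative `∂_J^σ φ` at `x`: the parts of `σ` are assigned, as orders of differentiation,
to distinct indices from `J`. An arbitrary assignment is used; at the points at which all the
variables with indices in `J` coincide, the value for symmetric `φ` does not depend on it. -/
def partialPartition (J : Finset (Fin N)) {g : ℕ} (σ : g.Partition) (φ : (Fin N → 𝕜) → 𝕜)
    (x : Fin N → 𝕜) : 𝕜 :=
  if h : ∃ i : Fin g → Fin N, IsAssignment J σ i then mixedPartial h.choose φ x else 0

/-- The combination `∂_J^g φ` at `x`, namely the sum over the partitions `σ` of `g` of
`(-1)^{g - l(σ)} g (l(σ) - 1)! / ∏_{h=1}^g h!^{m_h} m_h!` times `∂_J^σ φ`. -/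
def partialTotal (J : Finset (Fin N)) (g : ℕ) (φ : (Fin N → 𝕜) → 𝕜) (x : Fin N → 𝕜) : 𝕜 :=
  ∑ σ : g.Partition,
    (-1 : 𝕜) ^ (g - σ.parts.card) *
      ((g * Nat.factorial (σ.parts.card - 1) : ℕ) : 𝕜) /
        ((∏ h ∈ Icc 1 g, (Nat.factorial h ^ σ.parts.count h * Nat.factorial (σ.parts.count h)) : ℕ) : 𝕜) *
      partialPartition J σ φ x

/-- The set `A_{K,ν}` of the tuples `(a, b)` of a positive integer `a` and positive integers `b_k`,
`k ∈ K`, with `a + ∑_{k ∈ K} b_k = |K| + ν + 1`. -/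
def indexSet (K : Finset (Fin N)) (ν : ℕ) : Finset (ℕ × (K → ℕ)) :=
  (Icc 1 (#K + ν + 1) ×ˢ Fintype.piFinset fun _ => Icc 1 (#K + ν + 1)).filter
    fun q => q.1 + ∑ k, q.2 k = #K + ν + 1

theorem mem_indexSet (K : Finset (Fin N)) (ν : ℕ) (q : ℕ × (K → ℕ)) :
    q ∈ indexSet K ν ↔ 1 ≤ q.1 ∧ (∀ k, 1 ≤ q.2 k) ∧ q.1 + ∑ k, q.2 k = #K + ν + 1 := by
  simp only [indexSet, mem_filter, mem_product, mem_Icc, Fintype.mem_piFinset]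
  constructor
  · rintro ⟨⟨h1, h2⟩, h3⟩
    exact ⟨h1.1, fun k => (h2 k).1, h3⟩
  · rintro ⟨h1, h2, h3⟩
    refine ⟨⟨⟨h1, by omega⟩, fun k => ⟨h2 k, ?_⟩⟩, h3⟩
    have := Finset.single_le_sum (f := q.2) (fun _ _ => Nat.zero_le _) (mem_univ k)
    omega

end

end SymmDeriv

namespace SymmDeriv

noncomputable section

universe u

variable {𝕜 : Type*} [RCLike 𝕜] {N : ℕ}

/-! `D_I φ` behaves like a divided difference: `(z_j - z_i) D_I φ = D_{I \ j} φ - D_{I \ i} φ`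
(`sub_mul_diffOp`). Everything rests on this recursion and on comparing Taylor coefficients.

Suppose the limits of `D_{J'} φ` are known for all nonempty `J' ⊆ J` and depend only on `|J'|`.
Applying the recursion with `j = k ∈ I \ J` and `i ∈ J`, where the limit `x_k - y` of the divisor is
nonzero, determines the limit of `D_I φ` (`tendsto_diffOp_union`). The closed formula satisfies the
same recursion (`mul_confluentValue`), the sum over `A_{K,p-1}` being a combination of coefficients
of the power series of `∏ 1/(x_k - y - ε)`.

It remains to show that `D_J φ` tends to `∂_J^p φ` where all coordinates in `J` coincide
(`IsSymmetricFun.tendsto_diffOp`). The limit exists by Hadamard's lemma: symmetry turns `D_{J \ i}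
φ` into `D_{J \ j} φ` with two coordinates exchanged, so the quotient in the recursion is an
integral of a directional derivative (`IsSymmetricFun.exists_extension`). To find its value, let `p
= n + 1` and move one coordinate `x_k` to `y + ε`. By induction and the formula for `I \ J = {k}`,
the value of the extension there, times `(-1)^n ε^n`, is `φ_k + ∑_a (-1)^a ε^(a-1) ∂_{J \ k}^a φ`.
The coefficient of `ε^n` on both sides expresses the limit through the `∂_{J \ k}^a φ`, and this
relation is Newton's identity expressing power sums in the functions `h! e_h` (`sum_newtonCoeff`).
-/

/-! ### Iterated partial derivatives and permutations of the coordinates. -/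

/-- The iterated partial derivative `∂_{k_1} ⋯ ∂_{k_g} f` for a list of indices. -/
def iterPartial : List (Fin N) → ((Fin N → 𝕜) → 𝕜) → (Fin N → 𝕜) → 𝕜
  | [], f => f
  | k :: l, f => fun z => firstPartial k (iterPartial l f) z

theorem contDiffAt_firstPartial {m : ℕ} {f : (Fin N → 𝕜) → 𝕜} {x : Fin N → 𝕜} (k : Fin N)
    (hf : ContDiffAt 𝕜 (m + 1 : ℕ) f x) :
    ContDiffAt 𝕜 m (fun z => firstPartial k f z) x :=
  (hf.fderiv_right (m := (m : WithTop ℕ∞)) (by push_cast; exact le_rfl)).clm_apply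
    contDiffAt_const

theorem contDiffAt_iterPartial {f : (Fin N → 𝕜) → 𝕜} {x : Fin N → 𝕜} (l : List (Fin N)) :
    ∀ {m : ℕ}, ContDiffAt 𝕜 (m + l.length : ℕ) f x → ContDiffAt 𝕜 m (iterPartial l f) x := by
  induction l with
  | nil => intro m h; simpa [iterPartial] using h
  | cons k l ih =>
    intro m h
    refine contDiffAt_firstPartial k (ih ?_)
    convert h using 2
    simp only [List.length_cons]
    ring

theorem firstPartial_congr {f g : (Fin N → 𝕜) → 𝕜} {x : Fin N → 𝕜} (k : Fin N)
    (h : f =ᶠ[𝓝 x] g) : firstPartial k f x = firstPartial k g x := by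
  simp only [firstPartial, h.fderiv_eq]

theorem eventually_contDiffAt {n : ℕ} {f : (Fin N → 𝕜) → 𝕜} {x : Fin N → 𝕜}
    (h : ContDiffAt 𝕜 n f x) : ∀ᶠ z in 𝓝 x, ContDiffAt 𝕜 n f z :=
  h.eventually (by simp)

theorem mixedPartial_eq_iterPartial {f : (Fin N → 𝕜) → 𝕜} :
    ∀ {g : ℕ} (i : Fin g → Fin N) {x : Fin N → 𝕜}, ContDiffAt 𝕜 g f x →
      mixedPartial i f x = iterPartial (List.ofFn i) f x := by
  intro g
  induction g with
  | zero => intro i x _; simp [mixedPartial, iterPartial]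
  | succ g ih =>
    intro i x h
    have hd : DifferentiableAt 𝕜 (iteratedFDeriv 𝕜 g f) x :=
      (h.iteratedFDeriv_right (m := 1) (i := g) (by push_cast; rw [add_comm])).differentiableAt
        (by simp)
    have h1 : (fun z => mixedPartial (Fin.tail i) f z) =ᶠ[𝓝 x]
        iterPartial (List.ofFn (Fin.tail i)) f := by
      filter_upwards [eventually_contDiffAt h] with z hz
      exact ih _ (hz.of_le (by exact_mod_cast Nat.le_succ g))
    have h2 := firstPartial_congr (i 0) h1
    rw [List.ofFn_succ]
    change _ = firstPartial (i 0) (iterPartial (List.ofFn (Fin.tail i)) f) x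
    rw [← h2, mixedPartial, iteratedFDeriv_succ_apply_left, firstPartial]
    have h3 : HasFDerivAt (fun z => mixedPartial (Fin.tail i) f z) _ x :=
      hd.hasFDerivAt.continuousMultilinear_apply_const (fun q => Pi.single (Fin.tail i q) 1)
    rw [h3.fderiv]
    rfl

/-- Exchanging two neighbouring indices is the symmetry of the second derivative of `iterPartial l
f`, and such exchanges generate all permutations of a list. -/
theorem iterPartial_perm {f : (Fin N → 𝕜) → 𝕜} {l l' : List (Fin N)} (hl : l.Perm l') :
    ∀ {x : Fin N → 𝕜}, ContDiffAt 𝕜 l.length f x → iterPartial l f x = iterPartial l' f x := by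
  induction hl with
  | nil => intros; rfl
  | cons k _ ih =>
    intro x h
    refine firstPartial_congr k ?_
    filter_upwards [eventually_contDiffAt h] with z hz
    exact ih (hz.of_le (by simp))
  | swap a b l =>
    intro x h
    have h2 : ContDiffAt 𝕜 2 (iterPartial l f) x := by
      refine contDiffAt_iterPartial (m := 2) l (h.of_le ?_)
      simp only [List.length_cons]
      exact_mod_cast (by omega)
    have hs := h2.isSymmSndFDerivAt (by simp)
    have hd : DifferentiableAt 𝕜 (fderiv 𝕜 (iterPartial l f)) x :=
      (h2.fderiv_right (m := 1) (by norm_num)).differentiableAt (by simp)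
    have key : ∀ c d : Fin N, iterPartial (c :: d :: l) f x =
        fderiv 𝕜 (fderiv 𝕜 (iterPartial l f)) x (Pi.single c 1) (Pi.single d 1) := by
      intro c d
      simp only [iterPartial, firstPartial]
      rw [fderiv_clm_apply hd (by fun_prop)]
      simp
    rw [key, key]
    exact hs _ _
  | trans h1 h2 ih1 ih2 =>
    intro x h
    rw [ih1 h, ih2 (by rwa [← h1.length_eq])]

/-- The permutation of the coordinates by `π`. -/
def permCoord (𝕜 : Type*) [RCLike 𝕜] (π : Equiv.Perm (Fin N)) : (Fin N → 𝕜) ≃L[𝕜] (Fin N → 𝕜) :=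
  (LinearEquiv.funCongrLeft 𝕜 𝕜 π).toContinuousLinearEquiv

@[simp] theorem permCoord_apply (π : Equiv.Perm (Fin N)) (z : Fin N → 𝕜) :
    permCoord 𝕜 π z = z ∘ π := rfl

theorem single_comp_perm (π : Equiv.Perm (Fin N)) (k : Fin N) :
    (Pi.single (π k) 1 : Fin N → 𝕜) ∘ π = Pi.single k 1 := by
  ext j
  simp [Pi.single_apply]

/-- Two functions are needed because the partial derivatives of a symmetric function are no longer
symmetric; in this form the chain rule can be iterated along a list. -/
theorem firstPartial_of_comp_perm {f g : (Fin N → 𝕜) → 𝕜} (π : Equiv.Perm (Fin N))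
    (h : ∀ z, f z = g (z ∘ π)) (k : Fin N) (z : Fin N → 𝕜) :
    firstPartial (π k) f z = firstPartial k g (z ∘ π) := by
  have : f = g ∘ permCoord 𝕜 π := funext h
  rw [this, firstPartial, ContinuousLinearEquiv.comp_right_fderiv]
  simp only [ContinuousLinearMap.comp_apply, ContinuousLinearEquiv.coe_coe, permCoord_apply,
    single_comp_perm, firstPartial]

theorem IsSymmetricFun.iterPartial_map {f : (Fin N → 𝕜) → 𝕜} (hf : IsSymmetricFun f)
    (π : Equiv.Perm (Fin N)) (l : List (Fin N)) :
    ∀ z, iterPartial (l.map π) f z = iterPartial l f (z ∘ π) := by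
  induction l with
  | nil => intro z; exact (hf π z).symm
  | cons k l ih => intro z; exact firstPartial_of_comp_perm π ih k z

theorem IsSymmetricFun.firstPartial_perm {f : (Fin N → 𝕜) → 𝕜} (hf : IsSymmetricFun f)
    (π : Equiv.Perm (Fin N)) (k : Fin N) (z : Fin N → 𝕜) :
    firstPartial (π k) f z = firstPartial k f (z ∘ π) :=
  hf.iterPartial_map π [k] z

/-- Label an index in `J` by its multiplicity in the assignment and any other index by itself. Both
labelings have fibres of equal size, so some permutation matches them. Multiplicity `0` does not
occur in `σ`; its fibre is what the `l(σ)` occurring indices leave over in `J`. -/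
theorem exists_perm_of_isAssignment {J : Finset (Fin N)} {g : ℕ} {σ : g.Partition}
    {i i' : Fin g → Fin N} (hi : IsAssignment J σ i) (hi' : IsAssignment J σ i') :
    ∃ π : Equiv.Perm (Fin N), (∀ k ∈ J, π k ∈ J) ∧ (∀ k ∉ J, π k = k) ∧
      ∀ k, #{q : Fin g | i' q = π k} = #{q : Fin g | i q = k} := by
  classical
  let cnt : (Fin g → Fin N) → Fin N → ℕ := fun i k => #{q : Fin g | i q = k}
  let F : (Fin g → Fin N) → Fin N → ℕ ⊕ Fin N := fun i k =>
    if k ∈ J then Sum.inl (cnt i k) else Sum.inr k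
  have hpos : ∀ i : Fin g → Fin N, IsAssignment J σ i → ∀ c, c ≠ 0 →
      #{k ∈ J | cnt i k = c} = σ.parts.count c := by
    intro i hi c hc
    rw [← hi.2, Multiset.count_map, Finset.card_def]
    congr 1
    rw [← Finset.filter_val]
    congr 1
    ext k
    simp only [Finset.mem_filter, Finset.mem_image, mem_univ, true_and]
    constructor
    · rintro ⟨_, h2⟩
      refine ⟨?_, h2.symm⟩
      have : 0 < cnt i k := by omega
      obtain ⟨q, hq⟩ := Finset.card_pos.1 this
      exact ⟨q, by simpa using hq⟩
    · rintro ⟨⟨q, rfl⟩, h2⟩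
      exact ⟨hi.1 q, h2.symm⟩
  have hne : ∀ i : Fin g → Fin N, IsAssignment J σ i →
      #{k ∈ J | cnt i k ≠ 0} = σ.parts.card := by
    intro i hi
    rw [← hi.2, Multiset.card_map, Finset.card_val]
    congr 1
    ext k
    simp only [Finset.mem_filter, Finset.mem_image, mem_univ, true_and]
    constructor
    · rintro ⟨_, h2⟩
      obtain ⟨q, hq⟩ := Finset.card_pos.1 (Nat.pos_of_ne_zero h2)
      exact ⟨q, by simpa using hq⟩
    · rintro ⟨q, rfl⟩
      exact ⟨hi.1 q, (Finset.card_pos.2 ⟨q, by simp⟩).ne'⟩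
  have hcard : ∀ c, #{k ∈ J | cnt i k = c} = #{k ∈ J | cnt i' k = c} := by
    intro c
    by_cases hc : c = 0
    · subst hc
      have h1 := Finset.card_filter_add_card_filter_not (s := J) (fun k => cnt i k = 0)
      have h2 := Finset.card_filter_add_card_filter_not (s := J) (fun k => cnt i' k = 0)
      have h3 := hne i hi
      have h4 := hne i' hi'
      simp only [ne_eq] at h3 h4
      omega
    · rw [hpos i hi c hc, hpos i' hi' c hc]
  have hfib : ∀ s, Nonempty ({k // F i k = s} ≃ {k // F i' k = s}) := by
    intro s
    refine Fintype.card_eq.1 ?_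
    rw [Fintype.card_subtype, Fintype.card_subtype]
    cases s with
    | inl c =>
      have : ∀ i : Fin g → Fin N, ({k | F i k = Sum.inl c} : Finset (Fin N)) =
          {k ∈ J | cnt i k = c} := by
        intro i
        ext k
        by_cases hk : k ∈ J <;> simp [F, hk]
      rw [this, this, hcard]
    | inr k =>
      congr 1
      ext j
      by_cases hj : j ∈ J <;> simp [F, hj]
  let π : Equiv.Perm (Fin N) := Equiv.ofFiberEquiv fun s => (hfib s).some
  have hπ : ∀ k, F i' (π k) = F i k := fun k => Equiv.ofFiberEquiv_map _ k
  have hJ : ∀ k ∈ J, π k ∈ J ∧ cnt i' (π k) = cnt i k := by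
    intro k hk
    have := hπ k
    by_cases h : π k ∈ J
    · simp only [F, h, hk, if_true] at this
      exact ⟨h, Sum.inl.inj this⟩
    · simp [F, h, hk] at this
  have hJ' : ∀ k ∉ J, π k = k := by
    intro k hk
    have := hπ k
    by_cases h : π k ∈ J
    · simp [F, h, hk] at this
    · simpa [F, h, hk] using this
  refine ⟨π, fun k hk => (hJ k hk).1, hJ', fun k => ?_⟩
  by_cases hk : k ∈ J
  · exact (hJ k hk).2
  · rw [hJ' k hk]
    have : ∀ i : Fin g → Fin N, IsAssignment J σ i → #{q : Fin g | i q = k} = 0 := by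
      intro i hi
      rw [Finset.card_eq_zero, Finset.filter_eq_empty_iff]
      rintro q - rfl
      exact hk (hi.1 q)
    rw [this i hi, this i' hi']

theorem count_ofFn {α : Type*} [DecidableEq α] {g : ℕ} (i : Fin g → α) (k : α) :
    (List.ofFn i).count k = #{q : Fin g | i q = k} := by
  rw [← Multiset.coe_count, ← Fin.univ_val_map, Multiset.count_map, Finset.card_def,
    Finset.filter_val]
  simp only [eq_comm]

theorem IsSymmetricFun.mixedPartial_eq {φ : (Fin N → 𝕜) → 𝕜} (hφ : IsSymmetricFun φ)
    {J : Finset (Fin N)} {x : Fin N → 𝕜} {y : 𝕜} (hJ : ∀ i ∈ J, x i = y) {g : ℕ}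
    (hg : ContDiffAt 𝕜 g φ x) {σ : g.Partition} {i i' : Fin g → Fin N}
    (hi : IsAssignment J σ i) (hi' : IsAssignment J σ i') :
    mixedPartial i φ x = mixedPartial i' φ x := by
  obtain ⟨π, h1, h2, h3⟩ := exists_perm_of_isAssignment hi hi'
  have hx : x ∘ π = x := by
    ext k
    by_cases hk : k ∈ J
    · simp [hJ k hk, hJ _ (h1 k hk)]
    · simp [h2 k hk]
  have hp : (List.ofFn i').Perm ((List.ofFn i).map π) := by
    rw [List.perm_iff_count]
    intro k
    obtain ⟨j, rfl⟩ := π.surjective k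
    rw [List.count_map_of_injective _ _ π.injective, count_ofFn, count_ofFn, h3]
  rw [mixedPartial_eq_iterPartial i hg, mixedPartial_eq_iterPartial i' hg,
    iterPartial_perm hp (by simpa using hg), hφ.iterPartial_map, hx]

theorem IsSymmetricFun.partialPartition_eq {φ : (Fin N → 𝕜) → 𝕜} (hφ : IsSymmetricFun φ)
    {J : Finset (Fin N)} {x : Fin N → 𝕜} {y : 𝕜} (hJ : ∀ i ∈ J, x i = y) {g : ℕ}
    (hg : ContDiffAt 𝕜 g φ x) {σ : g.Partition} {i : Fin g → Fin N}
    (hi : IsAssignment J σ i) : partialPartition J σ φ x = mixedPartial i φ x := by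
  have h : ∃ i : Fin g → Fin N, IsAssignment J σ i := ⟨i, hi⟩
  rw [partialPartition, dif_pos h]
  exact hφ.mixedPartial_eq hJ hg h.choose_spec hi

theorem card_parts_le {g : ℕ} (σ : g.Partition) : σ.parts.card ≤ g := by
  conv_rhs => rw [← σ.parts_sum]
  simpa using Multiset.card_nsmul_le_sum (s := σ.parts) (a := 1) fun h hh => σ.parts_pos hh

theorem IsAssignment.mono {J J' : Finset (Fin N)} (hJ : J' ⊆ J) {g : ℕ} {σ : g.Partition}
    {i : Fin g → Fin N} (hi : IsAssignment J' σ i) : IsAssignment J σ i :=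
  ⟨fun q => hJ (hi.1 q), hi.2⟩

/-- The bound `g ≤ #J'` ensures that every partition of `g` has an assignment in `J'`, which also
serves for `J`. Hence the limits of `D_{J'} φ` will depend only on `#J'`, as `tendsto_diffOp_union`
requires. -/
theorem IsSymmetricFun.partialTotal_subset {φ : (Fin N → 𝕜) → 𝕜} (hφ : IsSymmetricFun φ)
    {J J' : Finset (Fin N)} (hJJ : J' ⊆ J) {x : Fin N → 𝕜} {y : 𝕜} (hJ : ∀ i ∈ J, x i = y)
    {g : ℕ} (hg : ContDiffAt 𝕜 g φ x) (hgJ : g ≤ #J') :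
    partialTotal J' g φ x = partialTotal J g φ x := by
  refine Finset.sum_congr rfl fun σ _ => ?_
  obtain ⟨i, hi⟩ := exists_isAssignment J' σ ((card_parts_le σ).trans hgJ)
  rw [hφ.partialPartition_eq (fun i hi => hJ i (hJJ hi)) hg hi,
    hφ.partialPartition_eq hJ hg (hi.mono hJJ)]

/-! ### Integrals over the unit interval depending on a parameter. -/

section ParametricIntegral

variable {𝕜 : Type*} [RCLike 𝕜]
  {V : Type*} [NormedAddCommGroup V]
  {E : Type*} [NormedAddCommGroup E]

theorem exists_bound_of_continuousOn [ProperSpace V] {U : Set V} (hU : IsOpen U) {g : V → ℝ → E}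
    (hg : ContinuousOn (Function.uncurry g) (U ×ˢ Set.Icc 0 1)) {z : V} (hz : z ∈ U) :
    ∃ s ∈ 𝓝 z, s ⊆ U ∧ ∃ C, ∀ w ∈ s, ∀ t ∈ Set.Icc (0 : ℝ) 1, ‖g w t‖ ≤ C := by
  obtain ⟨r, hr, hrU⟩ := Metric.nhds_basis_closedBall.mem_iff.1 (hU.mem_nhds hz)
  obtain ⟨C, hC⟩ := ((isCompact_closedBall z r).prod isCompact_Icc).exists_bound_of_continuousOn
    (hg.mono (Set.prod_mono hrU le_rfl))
  exact ⟨_, Metric.closedBall_mem_nhds z hr, hrU, C, fun w hw t ht => hC (w, t) ⟨hw, ht⟩⟩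

theorem continuousOn_section {U : Set V} {g : V → ℝ → E}
    (hg : ContinuousOn (Function.uncurry g) (U ×ˢ Set.Icc 0 1)) {z : V} (hz : z ∈ U) :
    ContinuousOn (g z) (Set.Icc 0 1) :=
  hg.comp (f := fun t : ℝ => (z, t)) (by fun_prop) fun t ht => ⟨hz, ht⟩

theorem aestronglyMeasurable_section {U : Set V} {g : V → ℝ → E}
    (hg : ContinuousOn (Function.uncurry g) (U ×ˢ Set.Icc 0 1)) {z : V} (hz : z ∈ U) :
    MeasureTheory.AEStronglyMeasurable (g z)
      (MeasureTheory.volume.restrict (Set.uIoc (0 : ℝ) 1)) := by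
  rw [Set.uIoc_of_le zero_le_one]
  exact ((continuousOn_section hg hz).mono Set.Ioc_subset_Icc_self).aestronglyMeasurable
    measurableSet_Ioc

theorem continuousOn_integral_unitInterval [ProperSpace V] [NormedSpace ℝ E] {U : Set V} (hU : IsOpen U) {g : V → ℝ → E}
    (hg : ContinuousOn (Function.uncurry g) (U ×ˢ Set.Icc 0 1)) :
    ContinuousOn (fun z => ∫ t in (0 : ℝ)..1, g z t) U := by
  intro z hz
  obtain ⟨s, hs, hsU, C, hC⟩ := exists_bound_of_continuousOn hU hg hz
  refine ContinuousAt.continuousWithinAt ?_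
  refine intervalIntegral.continuousAt_of_dominated_interval (bound := fun _ => C) ?_ ?_ ?_ ?_
  · filter_upwards [hs] with w hw
    exact aestronglyMeasurable_section hg (hsU hw)
  · filter_upwards [hs] with w hw
    refine .of_forall fun t ht => hC w hw t ?_
    rw [Set.uIoc_of_le zero_le_one] at ht
    exact Set.Ioc_subset_Icc_self ht
  · simp
  · refine .of_forall fun t ht => ?_
    rw [Set.uIoc_of_le zero_le_one] at ht
    have : ContinuousOn (fun w => g w t) U :=
      hg.comp (f := fun w : V => (w, t)) (by fun_prop)
        fun w hw => ⟨hw, Set.Ioc_subset_Icc_self ht⟩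
    exact this.continuousAt (hU.mem_nhds hz)

theorem hasFDerivAt_integral_unitInterval [ProperSpace V] {U : Set V} (hU : IsOpen U) {g : V → ℝ → E}
    [NormedSpace 𝕜 V] [NormedSpace ℝ E] [NormedSpace 𝕜 E] [SMulCommClass 𝕜 ℝ E]
    (hg : ContinuousOn (Function.uncurry g) (U ×ˢ Set.Icc 0 1)) {g' : V → ℝ → V →L[𝕜] E}
    (hg' : ContinuousOn (Function.uncurry g') (U ×ˢ Set.Icc 0 1))
    (hd : ∀ z ∈ U, ∀ t ∈ Set.Icc (0 : ℝ) 1, HasFDerivAt (fun w => g w t) (g' z t) z) {z : V}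
    (hz : z ∈ U) :
    HasFDerivAt (fun z => ∫ t in (0 : ℝ)..1, g z t) (∫ t in (0 : ℝ)..1, g' z t) z := by
  obtain ⟨s, hs, hsU, C, hC⟩ := exists_bound_of_continuousOn hU hg' hz
  refine intervalIntegral.hasFDerivAt_integral_of_dominated_of_fderiv_le
    (bound := fun _ => C) hs ?_ ?_ ?_ ?_ ?_ ?_
  · filter_upwards [hs] with w hw
    exact aestronglyMeasurable_section hg (hsU hw)
  · refine ContinuousOn.intervalIntegrable ?_
    rw [Set.uIcc_of_le zero_le_one]
    exact continuousOn_section hg hz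
  · exact aestronglyMeasurable_section hg' hz
  · refine .of_forall fun t ht w hw => hC w hw t ?_
    rw [Set.uIoc_of_le zero_le_one] at ht
    exact Set.Ioc_subset_Icc_self ht
  · simp
  · refine .of_forall fun t ht w hw => hd w (hsU hw) t ?_
    rw [Set.uIoc_of_le zero_le_one] at ht
    exact Set.Ioc_subset_Icc_self ht

end ParametricIntegral

/-- Averaging a `C^m` function over a continuous path of linear changes of variables gives a
`C^m` function. -/
theorem contDiffOn_integral_comp {𝕜 : Type u} [RCLike 𝕜]
    {V : Type u} [NormedAddCommGroup V] [NormedSpace 𝕜 V] [ProperSpace V]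
    {A : ℝ → V →L[𝕜] V} (hA : Continuous A) {U : Set V} (hU : IsOpen U)
    (hAU : ∀ t ∈ Set.Icc (0 : ℝ) 1, ∀ z ∈ U, A t z ∈ U) (m : ℕ) :
    ∀ {E E' : Type u} [NormedAddCommGroup E] [NormedSpace 𝕜 E]
      [NormedAddCommGroup E'] [NormedSpace ℝ E'] [NormedSpace 𝕜 E'] [SMulCommClass 𝕜 ℝ E']
      {L : ℝ → E →L[𝕜] E'} {F : V → E}, Continuous L → ContDiffOn 𝕜 m F U →
      ContDiffOn 𝕜 m (fun z => ∫ t in (0 : ℝ)..1, L t (F (A t z))) U := by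
  have hcont : ∀ {E E' : Type u} [NormedAddCommGroup E] [NormedSpace 𝕜 E]
      [NormedAddCommGroup E'] [NormedSpace 𝕜 E'] {L : ℝ → E →L[𝕜] E'} {F : V → E},
      Continuous L → ContinuousOn F U →
      ContinuousOn (Function.uncurry fun z t => L t (F (A t z))) (U ×ˢ Set.Icc 0 1) := by
    intro E E' _ _ _ _ L F hL hF
    have h1 : ContinuousOn (fun q : V × ℝ => F (A q.2 q.1)) (U ×ˢ Set.Icc 0 1) :=
      hF.comp (Continuous.continuousOn (by fun_prop)) fun q hq => hAU _ hq.2 _ hq.1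
    exact ContinuousOn.clm_apply (by fun_prop) h1
  induction m with
  | zero =>
    intro E E' _ _ _ _ _ _ L F hL hF
    rw [Nat.cast_zero, contDiffOn_zero] at *
    exact continuousOn_integral_unitInterval hU (hcont hL hF)
  | succ m ih =>
    intro E E' _ _ _ _ _ _ L F hL hF
    have hF' := (contDiffOn_succ_iff_fderiv_of_isOpen (n := m) hU).1 (by exact_mod_cast hF)
    -- The derivative of `L t ∘ F ∘ A t` has the same shape, with `fderiv 𝕜 F` for `F` and `L'` for
    -- `L`. This is why the induction carries `L` and varies `E` and `E'`.
    let L' : ℝ → (V →L[𝕜] E) →L[𝕜] (V →L[𝕜] E') := fun t =>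
      (ContinuousLinearMap.compL 𝕜 V E E' (L t)).comp
        ((ContinuousLinearMap.compL 𝕜 V V E).flip (A t))
    have hL' : Continuous L' := by fun_prop
    have hder : ∀ z ∈ U, HasFDerivAt (fun z => ∫ t in (0 : ℝ)..1, L t (F (A t z)))
        (∫ t in (0 : ℝ)..1, L' t (fderiv 𝕜 F (A t z))) z := by
      intro z hz
      refine hasFDerivAt_integral_unitInterval hU (hcont hL hF.continuousOn)
        (g' := fun z t => L' t (fderiv 𝕜 F (A t z))) (hcont hL' hF'.2.2.continuousOn) ?_ hz
      intro z hz t ht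
      have h1 : HasFDerivAt F (fderiv 𝕜 F (A t z)) (A t z) :=
        ((hF'.1 _ (hAU t ht z hz)).differentiableAt
          (hU.mem_nhds (hAU t ht z hz))).hasFDerivAt
      exact (L t).hasFDerivAt.comp z (h1.comp z (A t).hasFDerivAt)
    have := (contDiffOn_succ_iff_fderiv_of_isOpen (n := m) (𝕜 := 𝕜)
      (f := fun z => ∫ t in (0 : ℝ)..1, L t (F (A t z))) hU).2
      ⟨fun z hz => (hder z hz).differentiableAt.differentiableWithinAt, by simp,
        (ih hL' hF'.2.2).congr fun z hz => (hder z hz).fderiv⟩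
    exact_mod_cast this

/-! ### The divided-difference recursion and the extension of `D_J φ` to coinciding coordinates. -/

theorem distinctOn_anti {𝕜 : Type*} {N : ℕ} {I I' : Finset (Fin N)} (h : I' ⊆ I) :
    distinctOn 𝕜 I ⊆ distinctOn 𝕜 I' :=
  fun _ hz => Set.InjOn.mono (by exact_mod_cast h) hz

theorem comp_swap_mem_distinctOn {𝕜 : Type*} {N : ℕ} {I : Finset (Fin N)} {i j : Fin N} (hi : i ∈ I) (hj : j ∈ I)
    {z : Fin N → 𝕜} (hz : z ∈ distinctOn 𝕜 I) :
    z ∘ Equiv.swap i j ∈ distinctOn 𝕜 I := by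
  have hmap : ∀ k ∈ I, Equiv.swap i j k ∈ I := by
    intro k hk
    rw [Equiv.swap_apply_def]
    split_ifs <;> assumption
  exact fun k hk l hl h => (Equiv.swap i j).injective (hz (hmap k hk) (hmap l hl) h)

/-- The factor `z j - z i` cancels the factor with index `j` in the denominator and removes the
summand `i = j`. -/
theorem diffOp_erase {I : Finset (Fin N)} {j : Fin N} (hj : j ∈ I) (φ : (Fin N → 𝕜) → 𝕜)
    {z : Fin N → 𝕜} (hz : z ∈ distinctOn 𝕜 I) :
    diffOp (I.erase j) φ z =
      ∑ i ∈ I, (z j - z i) * (firstPartial i φ z / ∏ l ∈ I.erase i, (z l - z i)) := by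
  rw [← Finset.add_sum_erase _ _ hj, sub_self, zero_mul, zero_add]
  refine Finset.sum_congr rfl fun i hi => ?_
  have hij := Finset.ne_of_mem_erase hi
  have hne : z j - z i ≠ 0 := fun h =>
    hij (hz (Finset.mem_of_mem_erase hi) hj (sub_eq_zero.1 h).symm)
  rw [← Finset.mul_prod_erase (I.erase i) (fun l => z l - z i)
    (Finset.mem_erase.2 ⟨hij.symm, hj⟩), Finset.erase_right_comm, mul_div_assoc',
    mul_div_mul_left _ _ hne]

/-- The recursion satisfied by the divided difference `D_I φ`. -/
theorem sub_mul_diffOp {I : Finset (Fin N)} {i j : Fin N} (hi : i ∈ I) (hj : j ∈ I)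
    (φ : (Fin N → 𝕜) → 𝕜) {z : Fin N → 𝕜} (hz : z ∈ distinctOn 𝕜 I) :
    (z j - z i) * diffOp I φ z = diffOp (I.erase j) φ z - diffOp (I.erase i) φ z := by
  rw [diffOp_erase hi φ hz, diffOp_erase hj φ hz, ← Finset.sum_sub_distrib, diffOp,
    Finset.mul_sum]
  exact Finset.sum_congr rfl fun a _ => by ring

theorem IsSymmetricFun.diffOp_map {φ : (Fin N → 𝕜) → 𝕜} (hφ : IsSymmetricFun φ)
    (π : Equiv.Perm (Fin N)) (I : Finset (Fin N)) (z : Fin N → 𝕜) :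
    diffOp (I.map π.toEmbedding) φ z = diffOp I φ (z ∘ π) := by
  simp only [diffOp, Finset.sum_map, Equiv.coe_toEmbedding, hφ.firstPartial_perm]
  refine Finset.sum_congr rfl fun i _ => ?_
  congr 1
  have : (I.map π.toEmbedding).erase (π i) = (I.erase i).map π.toEmbedding := by
    rw [Finset.map_erase]; rfl
  rw [this, Finset.prod_map]
  rfl

theorem map_swap_erase {I : Finset (Fin N)} {i j : Fin N} (hi : i ∈ I) (hj : j ∈ I) :
    (I.erase j).map (Equiv.swap i j).toEmbedding = I.erase i := by
  ext k
  simp only [Finset.mem_map_equiv, Equiv.symm_swap, Finset.mem_erase]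
  by_cases h1 : k = i
  · simp [h1]
  by_cases h2 : k = j
  · subst h2
    simp [h1, Ne.symm h1, hi, hj]
  · simp [Equiv.swap_apply_of_ne_of_ne h1 h2, h1, h2]

theorem sub_comp_swap (z : Fin N → 𝕜) {i j : Fin N} (hij : i ≠ j) :
    z - z ∘ Equiv.swap i j = (z j - z i) • (Pi.single j 1 - Pi.single i 1) := by
  ext k
  by_cases h1 : k = i
  · subst h1; simp [hij]
  by_cases h2 : k = j
  · subst h2; simp [h1]
  · simp [Equiv.swap_apply_of_ne_of_ne h1 h2, h1, h2]

theorem norm_comp_perm_le (z : Fin N → 𝕜) (π : Equiv.Perm (Fin N)) : ‖z ∘ π‖ ≤ ‖z‖ :=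
  (pi_norm_le_iff_of_nonneg (norm_nonneg z)).2 fun k => norm_le_pi_norm z (π k)

/-- The path of linear maps from the transposition of two coordinates to the identity. -/
def swapPath (𝕜 : Type*) [RCLike 𝕜] (i j : Fin N) (t : ℝ) : (Fin N → 𝕜) →L[𝕜] (Fin N → 𝕜) :=
  (1 - t) • (permCoord 𝕜 (Equiv.swap i j) : (Fin N → 𝕜) →L[𝕜] (Fin N → 𝕜)) +
    t • ContinuousLinearMap.id 𝕜 (Fin N → 𝕜)

theorem swapPath_apply (i j : Fin N) (t : ℝ) (z : Fin N → 𝕜) :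
    swapPath 𝕜 i j t z = (1 - t) • (z ∘ Equiv.swap i j) + t • z := rfl

theorem swapPath_mem_ball {i j : Fin N} {t : ℝ} (ht : t ∈ Set.Icc (0 : ℝ) 1) {x z : Fin N → 𝕜}
    {r : ℝ} (hx : x ∘ Equiv.swap i j = x) (hz : z ∈ Metric.ball x r) :
    swapPath 𝕜 i j t z ∈ Metric.ball x r := by
  rw [swapPath_apply]
  refine convex_ball x r ?_ hz (by linarith [ht.2]) ht.1 (by ring)
  rw [mem_ball_iff_norm] at hz ⊢
  refine lt_of_le_of_lt ?_ hz
  calc ‖z ∘ Equiv.swap i j - x‖ = ‖(z - x) ∘ Equiv.swap i j‖ := by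
        conv_lhs => rw [← hx]
        rfl
    _ ≤ _ := norm_comp_perm_le _ _

/-- If `φ` is symmetric and of class `C^(m+|J|)` near a point at which the coordinates with indices
in `J` coincide, then `D_J φ` extends to a function of class `C^m` near this point. -/
theorem IsSymmetricFun.exists_extension {𝕜 : Type u} [RCLike 𝕜] {φ : (Fin N → 𝕜) → 𝕜}
    (hφ : IsSymmetricFun φ) {x : Fin N → 𝕜} {y : 𝕜} (n : ℕ) :
    ∀ (J : Finset (Fin N)), #J = n + 1 → (∀ i ∈ J, x i = y) → ∀ m : ℕ,
      ContDiffAt 𝕜 (m + (n + 1) : ℕ) φ x →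
      ∃ G : (Fin N → 𝕜) → 𝕜, ContDiffAt 𝕜 m G x ∧
        ∀ᶠ z in 𝓝[distinctOn 𝕜 J] x, diffOp J φ z = G z := by
  induction n with
  | zero =>
    intro J hJ _ m h
    obtain ⟨i, rfl⟩ := Finset.card_eq_one.1 hJ
    exact ⟨_, contDiffAt_firstPartial i h, .of_forall fun z => by simp [diffOp]⟩
  | succ n ih =>
    intro J hJ hx m h
    obtain ⟨i, hi, j, hj, hij⟩ := Finset.one_lt_card.1 (show 1 < #J by omega)
    obtain ⟨ψ, hψ, hψD⟩ := ih (J.erase j) (by rw [Finset.card_erase_of_mem hj, hJ]; rfl)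
      (fun k hk => hx k (Finset.mem_of_mem_erase hk)) (m + 1)
      (by convert h using 2; ring)
    rw [eventually_nhdsWithin_iff] at hψD
    obtain ⟨r, hr, hball⟩ := Metric.eventually_nhds_iff_ball.1
      ((eventually_contDiffAt hψ).and hψD)
    -- Since the swap fixes `x`, the ball is stable under it and, by convexity, under the whole
    -- path.
    have hxs : x ∘ Equiv.swap i j = x := by
      have := sub_comp_swap x hij
      rw [hx i hi, hx j hj, sub_self, zero_smul, sub_eq_zero] at this
      exact this.symm
    have hA : Continuous (swapPath 𝕜 i j : ℝ → _) := by
      unfold swapPath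
      fun_prop
    have hAB : ∀ t ∈ Set.Icc (0 : ℝ) 1, ∀ z ∈ Metric.ball x r,
        swapPath 𝕜 i j t z ∈ Metric.ball x r := fun t ht z hz => swapPath_mem_ball ht hxs hz
    -- Hadamard's lemma: `ψ z - ψ (z ∘ swap i j)` is `z j - z i` times the integral of `F` along the
    -- segment joining the two points. The integral remains smooth where `z i = z j`, at the cost of
    -- one derivative.
    let F : (Fin N → 𝕜) → 𝕜 := fun z => fderiv 𝕜 ψ z (Pi.single j 1 - Pi.single i 1)
    have hF : ContDiffOn 𝕜 m F (Metric.ball x r) := fun z hz =>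
      ((((hball z hz).1.fderiv_right (m := (m : WithTop ℕ∞))
        (by push_cast; exact le_rfl)).clm_apply contDiffAt_const)).contDiffWithinAt
    have hG := contDiffOn_integral_comp hA Metric.isOpen_ball hAB m
      (L := fun _ => ContinuousLinearMap.id 𝕜 𝕜) continuous_const hF
    refine ⟨_, hG.contDiffAt (Metric.ball_mem_nhds x hr), ?_⟩
    rw [eventually_nhdsWithin_iff]
    filter_upwards [Metric.ball_mem_nhds x hr] with z hz hzJ
    have hne : z j - z i ≠ 0 := fun h0 => hij (hzJ hi hj (sub_eq_zero.1 h0).symm)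
    have h0 : swapPath 𝕜 i j 0 z = z ∘ Equiv.swap i j := by simp [swapPath_apply]
    have h1 : swapPath 𝕜 i j 1 z = z := by simp [swapPath_apply]
    have hD1 : diffOp (J.erase j) φ z = ψ z :=
      (hball z hz).2 (distinctOn_anti (Finset.erase_subset _ _) hzJ)
    -- By symmetry of `φ` the same extension `ψ` serves both terms of the recursion.
    have hD2 : diffOp (J.erase i) φ z = ψ (z ∘ Equiv.swap i j) := by
      rw [← map_swap_erase hi hj, hφ.diffOp_map]
      refine (hball _ (h0 ▸ hAB 0 (by simp) z hz)).2
        (distinctOn_anti (Finset.erase_subset _ _) (comp_swap_mem_distinctOn hi hj hzJ))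
    have hder : ∀ t ∈ Set.uIcc (0 : ℝ) 1, HasDerivAt (fun t => ψ (swapPath 𝕜 i j t z))
        ((z j - z i) * F (swapPath 𝕜 i j t z)) t := by
      intro t ht
      rw [Set.uIcc_of_le zero_le_one] at ht
      have hd : HasFDerivAt ψ (fderiv 𝕜 ψ (swapPath 𝕜 i j t z)) (swapPath 𝕜 i j t z) :=
        ((hball _ (hAB t ht z hz)).1.differentiableAt (by simp)).hasFDerivAt
      have hp : HasDerivAt (fun t => swapPath 𝕜 i j t z) (z - z ∘ Equiv.swap i j) t := by
        simp only [swapPath_apply]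
        have := (((hasDerivAt_id t).const_sub 1).smul_const (z ∘ Equiv.swap i j)).add
          ((hasDerivAt_id t).smul_const z)
        exact this.congr_deriv (by simp [sub_eq_neg_add])
      have := (hd.restrictScalars ℝ).comp_hasDerivAt t hp
      rw [sub_comp_swap z hij] at this
      exact this.congr_deriv (by simp [F])
    have hint := intervalIntegral.integral_eq_sub_of_hasDerivAt hder ?_
    · rw [h0, h1, ← hD1, ← hD2, ← sub_mul_diffOp hi hj φ hzJ,
        intervalIntegral.integral_const_mul] at hint
      exact (mul_left_cancel₀ hne hint).symm
    · refine ContinuousOn.intervalIntegrable ?_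
      rw [Set.uIcc_of_le zero_le_one]
      refine continuousOn_const.mul (hF.continuousOn.comp (Continuous.continuousOn ?_)
        fun t ht => hAB t ht z hz)
      fun_prop

/-! ### The sum over `A_{K,p-1}` and the passage from `J` to `I`. -/

/-- The power series in `ε` of `∏_{k ∈ K} 1 / (x_k - y - ε)`. -/
def kernelSeries (x : Fin N → 𝕜) (y : 𝕜) (K : Finset (Fin N)) : PowerSeries 𝕜 :=
  ∏ k ∈ K, PowerSeries.mk fun n => ((x k - y) ^ (n + 1))⁻¹

theorem C_sub_X_mul_mk_inv_pow {u : 𝕜} (hu : u ≠ 0) :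
    (PowerSeries.C u - PowerSeries.X) * PowerSeries.mk (fun n => (u ^ (n + 1))⁻¹) = 1 := by
  ext n
  cases n with
  | zero => simp [sub_mul, hu]
  | succ n =>
    rw [sub_mul, map_sub, PowerSeries.coeff_C_mul, PowerSeries.coeff_succ_X_mul,
      PowerSeries.coeff_mk, PowerSeries.coeff_mk, PowerSeries.coeff_one, if_neg (by omega)]
    field_simp
    ring

theorem C_sub_X_mul_kernelSeries {x : Fin N → 𝕜} {y : 𝕜} {K : Finset (Fin N)} {k : Fin N}
    (hk : k ∈ K) (hy : x k ≠ y) :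
    (PowerSeries.C (x k - y) - PowerSeries.X) * kernelSeries x y K =
      kernelSeries x y (K.erase k) := by
  rw [kernelSeries, ← Finset.mul_prod_erase K _ hk, ← mul_assoc,
    C_sub_X_mul_mk_inv_pow (sub_ne_zero.2 hy), one_mul, kernelSeries]

theorem mul_coeff_zero_kernelSeries {x : Fin N → 𝕜} {y : 𝕜} {K : Finset (Fin N)} {k : Fin N}
    (hk : k ∈ K) (hy : x k ≠ y) :
    (x k - y) * (kernelSeries x y K).coeff 0 = (kernelSeries x y (K.erase k)).coeff 0 := by
  rw [← C_sub_X_mul_kernelSeries hk hy]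
  simp [sub_mul]

theorem mul_coeff_succ_kernelSeries {x : Fin N → 𝕜} {y : 𝕜} {K : Finset (Fin N)} {k : Fin N}
    (hk : k ∈ K) (hy : x k ≠ y) (n : ℕ) :
    (x k - y) * (kernelSeries x y K).coeff (n + 1) =
      (kernelSeries x y (K.erase k)).coeff (n + 1) + (kernelSeries x y K).coeff n := by
  have h := congrArg (PowerSeries.coeff (n + 1)) (C_sub_X_mul_kernelSeries hk hy)
  rw [sub_mul, map_sub, PowerSeries.coeff_C_mul, PowerSeries.coeff_succ_X_mul] at h
  rw [← h, sub_add_cancel]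

/-- The sum over the index set `A_{K,p-1}` in terms of the coefficients of a power series. -/
theorem sum_indexSet {x : Fin N → 𝕜} {y : 𝕜} {K : Finset (Fin N)} {p : ℕ} (hp : 1 ≤ p)
    (c : ℕ → 𝕜) :
    ∑ q ∈ indexSet K (p - 1), (-1 : 𝕜) ^ (p - q.1) * c q.1 / ∏ k : K, (x k - y) ^ q.2 k =
      ∑ a ∈ Icc 1 p, (-1) ^ (p - a) * c a * (kernelSeries x y K).coeff (p - a) := by
  classical
  have h1 : kernelSeries x y K =
      ∏ k : K, PowerSeries.mk fun n => ((x k - y) ^ (n + 1))⁻¹ :=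
    (Finset.prod_coe_sort K fun k => PowerSeries.mk fun n => ((x k - y) ^ (n + 1))⁻¹).symm
  simp only [h1, PowerSeries.coeff_prod, PowerSeries.coeff_mk, Finset.mul_sum]
  rw [Finset.sum_sigma']
  symm
  -- The factor for `k` has coefficient `(x_k - y)^(-(n+1))` in degree `n`, so `b_k` is one more
  -- than the degree taken from it.
  refine Finset.sum_nbij' (fun s => (s.1, fun k => s.2 k + 1))
    (fun q => ⟨q.1, Finsupp.equivFunOnFinite.symm fun k => q.2 k - 1⟩) ?_ ?_ ?_ ?_ ?_
  · rintro ⟨a, l⟩ h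
    simp only [Finset.mem_sigma, Finset.mem_Icc, Finset.mem_finsuppAntidiag] at h
    simp only [mem_indexSet, Finset.sum_add_distrib, Finset.sum_const, Finset.card_univ,
      Fintype.card_coe, smul_eq_mul, mul_one]
    have hl : ∑ k, l k = p - a := h.2.1
    exact ⟨h.1.1, fun k => by omega, by omega⟩
  · rintro ⟨a, b⟩ h
    rw [mem_indexSet] at h
    obtain ⟨h1, h2, h3⟩ := h
    simp only at h1 h2 h3
    have h4 : ∑ k, b k = ∑ k, (b k - 1) + #K := by
      have : #K = ∑ k : K, 1 := by simp
      rw [this, ← Finset.sum_add_distrib]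
      exact Finset.sum_congr rfl fun k _ => by have := h2 k; omega
    simp only [Finset.mem_sigma, Finset.mem_Icc, Finset.mem_finsuppAntidiag,
      Finsupp.equivFunOnFinite_symm_apply_apply, Finset.subset_univ, and_true]
    omega
  · rintro ⟨a, l⟩ h
    simp only [Nat.add_sub_cancel]
    congr 1
    ext k
    simp
  · rintro ⟨a, b⟩ h
    rw [mem_indexSet] at h
    simp only [Finsupp.equivFunOnFinite_symm_apply_apply, Prod.mk.injEq, true_and]
    funext k
    have := h.2.1 k
    simp only at this
    omega
  · rintro ⟨a, l⟩ h
    simp only [Finset.prod_inv_distrib]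
    rw [div_eq_mul_inv]

/-- The value of `D_I φ` at a point at which the coordinates with indices in `J` equal `y` and those
with indices in `K = I \ J` are distinct, in terms of the values `c a` of the operators `D_{J'} φ`
for the subsets `J'` of `J` with `a` elements; here `p = |J|`. -/
def confluentValue (φ : (Fin N → 𝕜) → 𝕜) (x : Fin N → 𝕜) (y : 𝕜) (c : ℕ → 𝕜)
    (K : Finset (Fin N)) (p : ℕ) : 𝕜 :=
  (∑ k ∈ K, firstPartial k φ x / ((y - x k) ^ p * ∏ l ∈ K.erase k, (x l - x k))) +
    ∑ a ∈ Icc 1 p, (-1) ^ (p - a) * c a * (kernelSeries x y K).coeff (p - a)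

/-- This is the recursion `sub_mul_diffOp` for `k ∈ K` and an index of `J`, whose removal lowers `p`
by one. The sum over `a` obeys it because multiplying the kernel by `(x_k - y) - ε` removes its
factor for `k`. -/
theorem mul_confluentValue (φ : (Fin N → 𝕜) → 𝕜) {x : Fin N → 𝕜} {y : 𝕜} (c : ℕ → 𝕜)
    {K : Finset (Fin N)} (hy : ∀ k ∈ K, x k ≠ y) (hK : x ∈ distinctOn 𝕜 K) {k : Fin N}
    (hk : k ∈ K) (p : ℕ) :
    (x k - y) * confluentValue φ x y c K (p + 1) =
      confluentValue φ x y c (K.erase k) (p + 1) - confluentValue φ x y c K p := by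
  have h1 : (x k - y) *
      (∑ i ∈ K, firstPartial i φ x / ((y - x i) ^ (p + 1) * ∏ l ∈ K.erase i, (x l - x i))) =
      (∑ i ∈ K.erase k, firstPartial i φ x /
        ((y - x i) ^ (p + 1) * ∏ l ∈ (K.erase k).erase i, (x l - x i))) -
      ∑ i ∈ K, firstPartial i φ x / ((y - x i) ^ p * ∏ l ∈ K.erase i, (x l - x i)) := by
    -- Split `x_k - y = (x_k - x_i) - (y - x_i)`: one part cancels the factor for `k`, the other
    -- lowers the power of `y - x_i`.
    have hsum : (x k - y) * (∑ i ∈ K.erase k,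
        firstPartial i φ x / ((y - x i) ^ (p + 1) * ∏ l ∈ K.erase i, (x l - x i))) =
        (∑ i ∈ K.erase k, firstPartial i φ x /
          ((y - x i) ^ (p + 1) * ∏ l ∈ (K.erase k).erase i, (x l - x i))) -
        ∑ i ∈ K.erase k, firstPartial i φ x / ((y - x i) ^ p * ∏ l ∈ K.erase i, (x l - x i)) := by
      rw [Finset.mul_sum, ← Finset.sum_sub_distrib]
      refine Finset.sum_congr rfl fun i hi => ?_
      have hik := Finset.ne_of_mem_erase hi
      have hiK := Finset.mem_of_mem_erase hi
      have hne : x k - x i ≠ 0 := fun h => hik (hK hiK hk (sub_eq_zero.1 h).symm)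
      have hne' : y - x i ≠ 0 := sub_ne_zero.2 (hy i hiK).symm
      have hprod : ∏ l ∈ (K.erase k).erase i, (x l - x i) ≠ 0 := by
        refine Finset.prod_ne_zero_iff.2 fun l hl => sub_ne_zero.2 fun h => ?_
        have hl' := Finset.mem_erase.1 hl
        exact hl'.1 (hK (Finset.mem_of_mem_erase hl'.2) hiK h)
      rw [← Finset.mul_prod_erase (K.erase i) (fun l => x l - x i)
        (Finset.mem_erase.2 ⟨hik.symm, hk⟩), Finset.erase_right_comm]
      rw [Finset.erase_right_comm] at hprod
      field_simp
      ring
    have hterm : (x k - y) *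
        (firstPartial k φ x / ((y - x k) ^ (p + 1) * ∏ l ∈ K.erase k, (x l - x k))) =
        -(firstPartial k φ x / ((y - x k) ^ p * ∏ l ∈ K.erase k, (x l - x k))) := by
      have hne' : y - x k ≠ 0 := sub_ne_zero.2 (hy k hk).symm
      have hprod : ∏ l ∈ K.erase k, (x l - x k) ≠ 0 := by
        refine Finset.prod_ne_zero_iff.2 fun l hl => sub_ne_zero.2 fun h => ?_
        have hl' := Finset.mem_erase.1 hl
        exact hl'.1 (hK hl'.2 hk h)
      field_simp
      ring
    rw [← Finset.add_sum_erase K (fun i => firstPartial i φ x /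
        ((y - x i) ^ (p + 1) * ∏ l ∈ K.erase i, (x l - x i))) hk,
      ← Finset.add_sum_erase K (fun i => firstPartial i φ x /
        ((y - x i) ^ p * ∏ l ∈ K.erase i, (x l - x i))) hk, mul_add, hsum, hterm]
    ring
  have h2 : (x k - y) *
      (∑ a ∈ Icc 1 (p + 1), (-1) ^ (p + 1 - a) * c a * (kernelSeries x y K).coeff (p + 1 - a)) =
      (∑ a ∈ Icc 1 (p + 1), (-1) ^ (p + 1 - a) * c a *
        (kernelSeries x y (K.erase k)).coeff (p + 1 - a)) -
      ∑ a ∈ Icc 1 p, (-1) ^ (p - a) * c a * (kernelSeries x y K).coeff (p - a) := by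
    rw [Finset.sum_Icc_succ_top (by omega), Finset.sum_Icc_succ_top (by omega), mul_add,
      Finset.mul_sum, add_sub_right_comm, ← Finset.sum_sub_distrib]
    congr 1
    · refine Finset.sum_congr rfl fun a ha => ?_
      have : p + 1 - a = (p - a) + 1 := by have := Finset.mem_Icc.1 ha; omega
      rw [this, mul_left_comm, mul_coeff_succ_kernelSeries hk (hy k hk)]
      ring
    · rw [Nat.sub_self, mul_left_comm, mul_coeff_zero_kernelSeries hk (hy k hk)]
  rw [confluentValue, mul_add, h1, h2, confluentValue, confluentValue]
  ring

theorem continuousAt_firstPartial {φ : (Fin N → 𝕜) → 𝕜} {x : Fin N → 𝕜}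
    (hφ : ContDiffAt 𝕜 1 φ x) (k : Fin N) : ContinuousAt (fun z => firstPartial k φ z) x :=
  (contDiffAt_firstPartial (m := 0) k (by simpa using hφ)).continuousAt

theorem tendsto_diffOp_of_distinct {φ : (Fin N → 𝕜) → 𝕜} {x : Fin N → 𝕜}
    (hφ : ContDiffAt 𝕜 1 φ x) {K : Finset (Fin N)} (hK : x ∈ distinctOn 𝕜 K) :
    Tendsto (diffOp K φ) (𝓝 x) (𝓝 (diffOp K φ x)) := by
  refine tendsto_finsetSum _ fun i hi => Tendsto.div (continuousAt_firstPartial hφ i) ?_ ?_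
  · refine tendsto_finsetProd _ fun l _ => ?_
    exact ((continuous_apply l).sub (continuous_apply i)).tendsto x
  · refine Finset.prod_ne_zero_iff.2 fun l hl => sub_ne_zero.2 fun h => ?_
    exact Finset.ne_of_mem_erase hl (hK (Finset.mem_of_mem_erase hl) hi h)

/-- If `D_{J'} φ` has the limit `c |J'|` for all nonempty subsets `J'` of `J₀`, then the limits of
`D_I φ` are obtained from these. -/
theorem tendsto_diffOp_union {φ : (Fin N → 𝕜) → 𝕜} {x : Fin N → 𝕜} {y : 𝕜}
    (hφ : ContDiffAt 𝕜 1 φ x) {J₀ : Finset (Fin N)} {c : ℕ → 𝕜} (hJ₀ : ∀ i ∈ J₀, x i = y)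
    (hc : ∀ J ⊆ J₀, J.Nonempty → Tendsto (diffOp J φ) (𝓝[distinctOn 𝕜 J] x) (𝓝 (c #J)))
    (n : ℕ) : ∀ J K : Finset (Fin N), J ⊆ J₀ → #J + #K = n → (∀ k ∈ K, x k ≠ y) →
      x ∈ distinctOn 𝕜 K →
      Tendsto (diffOp (J ∪ K) φ) (𝓝[distinctOn 𝕜 (J ∪ K)] x)
        (𝓝 (confluentValue φ x y c K #J)) := by
  induction n with
  | zero =>
    intro J K hJ hn hy hK
    obtain rfl : J = ∅ := Finset.card_eq_zero.1 (by omega)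
    obtain rfl : K = ∅ := Finset.card_eq_zero.1 (by omega)
    have : diffOp ∅ φ = fun _ => 0 := by funext z; simp [diffOp]
    simpa [confluentValue, this] using tendsto_const_nhds
  | succ n ih =>
    intro J K hJ hn hy hK
    rcases J.eq_empty_or_nonempty with rfl | hJne
    · have := (tendsto_diffOp_of_distinct hφ hK).mono_left
        (nhdsWithin_le_nhds (s := distinctOn 𝕜 K))
      simpa [confluentValue, diffOp] using this
    rcases K.eq_empty_or_nonempty with rfl | hKne
    · have hpos := hJne.card_pos
      -- The kernel of the empty set is `1`, so only `a = #J` contributes.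
      have : confluentValue φ x y c ∅ #J = c #J := by
        rw [confluentValue, Finset.sum_empty, zero_add,
          Finset.sum_eq_single_of_mem #J (Finset.mem_Icc.2 ⟨hpos, le_rfl⟩)]
        · simp [kernelSeries]
        · intro a ha hne
          have := Finset.mem_Icc.1 ha
          rw [kernelSeries, Finset.prod_empty, PowerSeries.coeff_one, if_neg (by omega), mul_zero]
      rw [this, Finset.union_empty]
      exact hc J hJ hJne
    obtain ⟨i, hi⟩ := hJne
    obtain ⟨k, hk⟩ := hKne
    have hiK : i ∉ K := fun h => hy i h (hJ₀ i (hJ hi))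
    have hkJ : k ∉ J := fun h => hy k hk (hJ₀ k (hJ h))
    have hJcard := Finset.card_erase_add_one hi
    have hKcard := Finset.card_erase_add_one hk
    have e1 : (J ∪ K).erase k = J ∪ K.erase k := by
      rw [Finset.erase_union_distrib, Finset.erase_eq_of_notMem hkJ]
    have e2 : (J ∪ K).erase i = J.erase i ∪ K := by
      rw [Finset.erase_union_distrib, Finset.erase_eq_of_notMem hiK]
    have t1 := ih J (K.erase k) hJ (by omega) (fun l hl => hy l (Finset.mem_of_mem_erase hl))
      (distinctOn_anti (Finset.erase_subset _ _) hK)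
    have t2 := ih (J.erase i) K ((Finset.erase_subset _ _).trans hJ) (by omega) hy hK
    rw [← e1] at t1
    rw [← e2] at t2
    have t1' := t1.mono_left (nhdsWithin_mono x (distinctOn_anti (𝕜 := 𝕜)
      (Finset.erase_subset k (J ∪ K))))
    have t2' := t2.mono_left (nhdsWithin_mono x (distinctOn_anti (𝕜 := 𝕜)
      (Finset.erase_subset i (J ∪ K))))
    have t3 : Tendsto (fun z : Fin N → 𝕜 => z k - z i) (𝓝[distinctOn 𝕜 (J ∪ K)] x)
        (𝓝 (x k - y)) := by
      rw [← hJ₀ i (hJ hi)]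
      exact (((continuous_apply k).sub (continuous_apply i)).tendsto x).mono_left
        nhdsWithin_le_nhds
    have hne : x k - y ≠ 0 := sub_ne_zero.2 (hy k hk)
    have t4 := (t1'.sub t2').div t3 hne
    rw [← hJcard] at t4 ⊢
    rw [← mul_confluentValue φ c hy hK hk,
      mul_div_cancel_left₀ _ hne] at t4
    refine t4.congr' ?_
    filter_upwards [self_mem_nhdsWithin] with z hz
    have hzne : z k - z i ≠ 0 := fun h => hkJ (by
      rwa [hz (Finset.mem_union_right _ hk) (Finset.mem_union_left _ hi) (sub_eq_zero.1 h)])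
    rw [Pi.div_apply, ← sub_mul_diffOp (Finset.mem_union_left _ hi) (Finset.mem_union_right _ hk) φ hz]
    field_simp

/-! ### Newton's identities for the coefficients of `∂_J^g`. -/

/-- The coefficient in the expansion of a power sum in terms of elementary symmetric functions
`h! e_h`, for the monomial given by the multiset `s`. -/
def newtonCoeff (𝕜 : Type*) [RCLike 𝕜] (s : Multiset ℕ) : 𝕜 :=
  (-1 : 𝕜) ^ (s.sum - s.card) * ((s.sum * (s.card - 1).factorial : ℕ) : 𝕜) /
    ((∏ h ∈ s.toFinset, (h.factorial ^ s.count h * (s.count h).factorial) : ℕ) : 𝕜)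

theorem prod_factorial_eq {s : Multiset ℕ} {T : Finset ℕ} (hT : s.toFinset ⊆ T) :
    ∏ h ∈ s.toFinset, (h.factorial ^ s.count h * (s.count h).factorial) =
      ∏ h ∈ T, (h.factorial ^ s.count h * (s.count h).factorial) := by
  refine Finset.prod_subset hT fun h _ hh => ?_
  rw [Multiset.mem_toFinset, ← Multiset.count_eq_zero] at hh
  simp [hh]

theorem prod_factorial_erase {s : Multiset ℕ} {h : ℕ} (hh : h ∈ s) :
    ∏ j ∈ s.toFinset, (j.factorial ^ s.count j * (s.count j).factorial) =
      h.factorial * s.count h *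
        ∏ j ∈ (s.erase h).toFinset,
          (j.factorial ^ (s.erase h).count j * ((s.erase h).count j).factorial) := by
  rw [prod_factorial_eq (s := s.erase h) (T := s.toFinset)
    (Multiset.toFinset_subset.2 (Multiset.erase_subset _ _))]
  have hs : h ∈ s.toFinset := Multiset.mem_toFinset.2 hh
  rw [← Finset.mul_prod_erase _ _ hs, ← Finset.mul_prod_erase _ (fun j =>
    j.factorial ^ (s.erase h).count j * ((s.erase h).count j).factorial) hs, ← mul_assoc]
  congr 1
  · rw [Multiset.count_erase_self]
    obtain ⟨m, hm⟩ : ∃ m, s.count h = m + 1 :=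
      Nat.exists_eq_succ_of_ne_zero (Multiset.count_ne_zero.2 hh)
    rw [hm, Nat.add_sub_cancel, Nat.factorial_succ, pow_succ]
    ring
  · refine Finset.prod_congr rfl fun j hj => ?_
    rw [Multiset.count_erase_of_ne (Finset.ne_of_mem_erase hj)]

theorem card_le_sum {s : Multiset ℕ} (hs : ∀ h ∈ s, 0 < h) : s.card ≤ s.sum := by
  simpa using Multiset.card_nsmul_le_sum (s := s) (a := 1) hs

/-- Newton's identities, in terms of coefficients. -/
theorem newtonCoeff_eq_sum {s : Multiset ℕ} (hs : ∀ h ∈ s, 0 < h) (hcard : 2 ≤ s.card) :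
    newtonCoeff 𝕜 s =
      ∑ h ∈ s.toFinset, (-1 : 𝕜) ^ (h - 1) / h.factorial * newtonCoeff 𝕜 (s.erase h) := by
  set W : ℕ := ∏ h ∈ s.toFinset, (h.factorial ^ s.count h * (s.count h).factorial) with hW
  have hW0 : (W : 𝕜) ≠ 0 := by
    rw [Nat.cast_ne_zero]
    exact Finset.prod_ne_zero_iff.2 fun h _ =>
      mul_ne_zero (pow_ne_zero _ (Nat.factorial_ne_zero _)) (Nat.factorial_ne_zero _)
  have hterm : ∀ h ∈ s.toFinset,
      (-1 : 𝕜) ^ (h - 1) / h.factorial * newtonCoeff 𝕜 (s.erase h) =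
      (-1) ^ (s.sum - s.card) * (s.card - 2).factorial / W * (s.count h * (s.sum - h)) := by
    intro h hh
    rw [Multiset.mem_toFinset] at hh
    have hpos := hs h hh
    have hsum := Multiset.sum_erase hh
    have hc : (s.erase h).card = s.card - 1 := by rw [Multiset.card_erase_of_mem hh]; rfl
    have hle := card_le_sum (s := s.erase h) fun j hj => hs j (Multiset.mem_of_mem_erase hj)
    have hp := prod_factorial_erase hh
    rw [← hW] at hp
    have hcast : (s.sum : 𝕜) - h = ((s.erase h).sum : ℕ) := by
      rw [← hsum]; push_cast; ring
    rw [newtonCoeff, hp, hcast, hc]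
    have hexp : s.sum - s.card = (h - 1) + ((s.erase h).sum - (s.card - 1)) := by omega
    rw [hexp, pow_add, Nat.sub_sub]
    have h1 : (h.factorial : 𝕜) ≠ 0 := by exact_mod_cast Nat.factorial_ne_zero h
    have h2 : (s.count h : 𝕜) ≠ 0 := by exact_mod_cast Multiset.count_ne_zero.2 hh
    rw [hp] at hW0
    push_cast at hW0 ⊢
    have h3 := right_ne_zero_of_mul hW0
    field_simp
  rw [Finset.sum_congr rfl hterm, ← Finset.mul_sum]
  -- With `g` the sum and `l` the number of parts, `∑ m_h (g - h) = l g - g`; the factor `l - 1`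
  -- turns `(l - 2)!` into `(l - 1)!`.
  have h1 : ∑ h ∈ s.toFinset, ((s.count h : 𝕜) * (s.sum - h)) = s.sum * (s.card - 1 : ℕ) := by
    have e1 : ∑ h ∈ s.toFinset, (s.count h : 𝕜) = s.card := by
      rw [← Nat.cast_sum, Multiset.toFinset_sum_count_eq]
    have e2 : ∑ h ∈ s.toFinset, (s.count h : 𝕜) * h = s.sum := by
      conv_rhs => rw [Finset.sum_multiset_count s]
      push_cast
      simp
    simp only [mul_sub, Finset.sum_sub_distrib, ← Finset.sum_mul, e1, e2]
    rw [Nat.cast_sub (by omega)]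
    push_cast
    ring
  rw [h1, newtonCoeff, ← hW]
  obtain ⟨m, hm⟩ : ∃ m, s.card = m + 2 := ⟨s.card - 2, by omega⟩
  have e3 : s.card - 1 = m + 1 := by omega
  have e4 : s.card - 2 = m := by omega
  rw [e3, e4, Nat.factorial_succ]
  push_cast
  ring

theorem newtonCoeff_singleton (n : ℕ) :
    newtonCoeff 𝕜 {n + 1} = (-1) ^ n / (n.factorial : 𝕜) := by
  have h1 : (n.factorial : 𝕜) ≠ 0 := by exact_mod_cast Nat.factorial_ne_zero n
  have h2 : ((n : 𝕜) + 1) ≠ 0 := by exact_mod_cast Nat.succ_ne_zero n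
  simp only [newtonCoeff, Multiset.sum_singleton, Multiset.card_singleton, Nat.add_sub_cancel,
    Nat.sub_self, Nat.factorial_zero, mul_one, Multiset.toFinset_singleton, Finset.prod_singleton,
    Multiset.count_singleton_self, pow_one, Nat.factorial_succ, Nat.cast_mul,
    Nat.cast_add, Nat.cast_one]
  field_simp
  simp

/-- The multisets of positive integers with sum `g`. -/
def partsFinset (g : ℕ) : Finset (Multiset ℕ) :=
  (univ : Finset g.Partition).image Nat.Partition.parts

theorem mem_partsFinset {g : ℕ} {s : Multiset ℕ} :
    s ∈ partsFinset g ↔ (∀ h ∈ s, 0 < h) ∧ s.sum = g := by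
  simp only [partsFinset, Finset.mem_image, mem_univ, true_and]
  constructor
  · rintro ⟨σ, rfl⟩
    exact ⟨fun h hh => σ.parts_pos hh, σ.parts_sum⟩
  · rintro ⟨h1, h2⟩
    exact ⟨⟨s, fun {h} hh => h1 h hh, h2⟩, rfl⟩

theorem sum_partsFinset {g : ℕ} (f : Multiset ℕ → 𝕜) :
    ∑ s ∈ partsFinset g, f s = ∑ σ : g.Partition, f σ.parts :=
  Finset.sum_image fun _ _ _ _ h => Nat.Partition.ext h

/-- Newton's identities for the sums over partitions. -/
theorem sum_newtonCoeff (n : ℕ) (F : Multiset ℕ → 𝕜) :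
    ∑ σ : (n + 1).Partition, newtonCoeff 𝕜 σ.parts * F σ.parts =
      (-1) ^ n / n.factorial * F {n + 1} +
        ∑ a ∈ Icc 1 n, ∑ τ : a.Partition, (-1) ^ (n - a) / ((n + 1 - a).factorial : 𝕜) *
          newtonCoeff 𝕜 τ.parts * F ((n + 1 - a) ::ₘ τ.parts) := by
  rw [← sum_partsFinset fun s => newtonCoeff 𝕜 s * F s]
  -- The one-part partition is split off because the recursion for the coefficients needs at least
  -- two parts.
  have hn : {n + 1} ∈ partsFinset (n + 1) := by simp [mem_partsFinset]
  rw [← Finset.add_sum_erase _ _ hn, newtonCoeff_singleton]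
  congr 1
  have hR : ∀ a ∈ Icc 1 n, ∑ τ : a.Partition, (-1) ^ (n - a) / ((n + 1 - a).factorial : 𝕜) *
          newtonCoeff 𝕜 τ.parts * F ((n + 1 - a) ::ₘ τ.parts) =
      ∑ s ∈ partsFinset a, (-1) ^ (n - a) / ((n + 1 - a).factorial : 𝕜) *
          newtonCoeff 𝕜 s * F ((n + 1 - a) ::ₘ s) := fun a _ =>
    (sum_partsFinset fun s => (-1) ^ (n - a) / ((n + 1 - a).factorial : 𝕜) *
          newtonCoeff 𝕜 s * F ((n + 1 - a) ::ₘ s)).symm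
  have hL : ∀ s ∈ (partsFinset (n + 1)).erase {n + 1}, newtonCoeff 𝕜 s * F s =
      ∑ h ∈ s.toFinset,
        (-1 : 𝕜) ^ (h - 1) / h.factorial * newtonCoeff 𝕜 (s.erase h) * F s := by
    intro s hs
    rw [Finset.mem_erase, mem_partsFinset] at hs
    rw [newtonCoeff_eq_sum hs.2.1, Finset.sum_mul]
    by_contra hc
    have : s.card = 0 ∨ s.card = 1 := by omega
    rcases this with h0 | h1
    · rw [Multiset.card_eq_zero] at h0
      have := hs.2.2
      simp [h0] at this
    · obtain ⟨b, rfl⟩ := Multiset.card_eq_one.1 h1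
      have := hs.2.2
      rw [Multiset.sum_singleton] at this
      exact hs.1 (by rw [this])
  rw [Finset.sum_congr rfl hR, Finset.sum_congr rfl hL, Finset.sum_sigma', Finset.sum_sigma']
  -- A partition with a distinguished part size `h` corresponds to the partition of `a = n + 1 - h`
  -- left after removing one part `h`.
  refine Finset.sum_nbij' (fun q => ⟨n + 1 - q.2, q.1.erase q.2⟩)
    (fun q => ⟨(n + 1 - q.1) ::ₘ q.2, n + 1 - q.1⟩) ?_ ?_ ?_ ?_ ?_
  · rintro ⟨s, h⟩ hq
    simp only [Finset.mem_sigma, Finset.mem_erase, mem_partsFinset, Multiset.mem_toFinset,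
      Finset.mem_Icc] at hq ⊢
    obtain ⟨⟨h1, h2, h3⟩, h4⟩ := hq
    have hpos := h2 h h4
    have hsum := Multiset.sum_erase h4
    have hlt : (s.erase h).sum ≠ 0 := by
      intro h0
      have hcard := card_le_sum (s := s.erase h) fun j hj => h2 j (Multiset.mem_of_mem_erase hj)
      have he : s.erase h = 0 := Multiset.card_eq_zero.1 (by omega)
      have := Multiset.cons_erase h4
      rw [he] at this
      refine h1 ?_
      rw [← this]
      have : h = n + 1 := by omega
      rw [this]
      rfl
    exact ⟨by omega, fun j hj => h2 j (Multiset.mem_of_mem_erase hj), by omega⟩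
  · rintro ⟨a, s⟩ hq
    simp only [Finset.mem_sigma, Finset.mem_erase, mem_partsFinset, Multiset.mem_toFinset,
      Finset.mem_Icc, Multiset.mem_cons_self, and_true, Multiset.sum_cons, Multiset.mem_cons]
      at hq ⊢
    obtain ⟨⟨h1, h2⟩, h3, h4⟩ := hq
    refine ⟨fun h => ?_, ?_, by omega⟩
    · have := congrArg Multiset.card h
      simp only [Multiset.card_cons, Multiset.card_singleton, Nat.add_eq_right,
        Multiset.card_eq_zero] at this
      rw [this, Multiset.sum_zero] at h4
      omega
    · rintro j (rfl | hj)
      · omega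
      · exact h3 j hj
  · rintro ⟨s, h⟩ hq
    simp only [Finset.mem_sigma, Finset.mem_erase, mem_partsFinset, Multiset.mem_toFinset] at hq
    have := Multiset.sum_erase hq.2
    have h1 : n + 1 - (n + 1 - h) = h := by omega
    simp only [h1, Multiset.cons_erase hq.2]
  · rintro ⟨a, s⟩ hq
    simp only [Finset.mem_sigma, Finset.mem_Icc] at hq
    have h1 : n + 1 - (n + 1 - a) = a := by omega
    simp only [h1, Multiset.erase_cons_head]
  · rintro ⟨s, h⟩ hq
    simp only [Finset.mem_sigma, Finset.mem_erase, mem_partsFinset, Multiset.mem_toFinset] at hq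
    have := Multiset.sum_erase hq.2
    have hpos := hq.1.2.1 h hq.2
    have h1 : n + 1 - (n + 1 - h) = h := by omega
    have h2 : n - (n + 1 - h) = h - 1 := by omega
    simp only [h1, h2, Multiset.cons_erase hq.2]

theorem partialTotal_eq (J : Finset (Fin N)) (g : ℕ) (φ : (Fin N → 𝕜) → 𝕜) (x : Fin N → 𝕜) :
    partialTotal J g φ x =
      ∑ σ : g.Partition, newtonCoeff 𝕜 σ.parts * partialPartition J σ φ x := by
  refine Finset.sum_congr rfl fun σ _ => ?_
  rw [newtonCoeff, σ.parts_sum, prod_factorial_eq (T := Icc 1 g)]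
  intro h hh
  rw [Multiset.mem_toFinset] at hh
  have := Multiset.le_sum_of_mem hh
  rw [σ.parts_sum] at this
  exact Finset.mem_Icc.2 ⟨σ.parts_pos hh, this⟩

/-! ### Asymptotic expansions in `ε` and their leading coefficients. -/

/-- The function `f` agrees near `0` with a polynomial of degree at most `n` up to `o(ε^n)`, and `c`
is the coefficient of `ε^n` in this polynomial. -/
def HasTopCoeff (f : 𝕜 → 𝕜) (n : ℕ) (c : 𝕜) : Prop :=
  ∃ P : Polynomial 𝕜, P.natDegree ≤ n ∧ P.coeff n = c ∧
    (fun ε => f ε - P.eval ε) =o[𝓝[≠] (0 : 𝕜)] fun ε => ε ^ n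

namespace HasTopCoeff

theorem add {f g : 𝕜 → 𝕜} {n : ℕ} {c d : 𝕜} (hf : HasTopCoeff f n c) (hg : HasTopCoeff g n d) :
    HasTopCoeff (fun ε => f ε + g ε) n (c + d) := by
  obtain ⟨P, hP, hc, h1⟩ := hf
  obtain ⟨Q, hQ, hd, h2⟩ := hg
  refine ⟨P + Q, Polynomial.natDegree_add_le_of_degree_le hP hQ, by simp [hc, hd], ?_⟩
  refine (h1.add h2).congr_left fun ε => ?_
  simp only [Polynomial.eval_add]
  ring

theorem const_mul {f : 𝕜 → 𝕜} {n : ℕ} {c : 𝕜} (a : 𝕜) (hf : HasTopCoeff f n c) :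
    HasTopCoeff (fun ε => a * f ε) n (a * c) := by
  obtain ⟨P, hP, hc, h1⟩ := hf
  refine ⟨Polynomial.C a * P, (Polynomial.natDegree_C_mul_le _ _).trans hP, by simp [hc], ?_⟩
  refine (h1.const_mul_left a).congr_left fun ε => ?_
  simp only [Polynomial.eval_mul, Polynomial.eval_C]
  ring

theorem zero (n : ℕ) : HasTopCoeff (fun _ : 𝕜 => 0) n 0 :=
  ⟨0, by simp, by simp, by simp⟩

theorem sum {ι : Type*} {s : Finset ι} {f : ι → 𝕜 → 𝕜} {n : ℕ} {c : ι → 𝕜}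
    (h : ∀ i ∈ s, HasTopCoeff (f i) n (c i)) :
    HasTopCoeff (fun ε => ∑ i ∈ s, f i ε) n (∑ i ∈ s, c i) := by
  classical
  induction s using Finset.induction_on with
  | empty => simpa using zero n
  | insert i s hi ih =>
    simp only [Finset.sum_insert hi]
    exact (h i (Finset.mem_insert_self _ _)).add
      (ih fun j hj => h j (Finset.mem_insert_of_mem hj))

theorem pow_mul {f : 𝕜 → 𝕜} {n : ℕ} {c : 𝕜} (j : ℕ) (hf : HasTopCoeff f n c) :
    HasTopCoeff (fun ε => ε ^ j * f ε) (j + n) c := by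
  obtain ⟨P, hP, hc, h1⟩ := hf
  refine ⟨Polynomial.X ^ j * P, ?_, ?_, ?_⟩
  · refine Polynomial.natDegree_mul_le.trans ?_
    simpa using hP
  · rw [add_comm, Polynomial.coeff_X_pow_mul, hc]
  · have := (Asymptotics.isBigO_refl (fun ε : 𝕜 => ε ^ j) (𝓝[≠] 0)).mul_isLittleO h1
    simp only [← pow_add] at this
    refine this.congr_left fun ε => ?_
    simp only [Polynomial.eval_mul, Polynomial.eval_pow, Polynomial.eval_X]
    ring

theorem congr' {f g : 𝕜 → 𝕜} {n : ℕ} {c : 𝕜} (hf : HasTopCoeff f n c)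
    (h : f =ᶠ[𝓝[≠] 0] g) : HasTopCoeff g n c := by
  obtain ⟨P, hP, hc, h1⟩ := hf
  refine ⟨P, hP, hc, h1.congr' ?_ .rfl⟩
  filter_upwards [h] with ε hε
  rw [hε]

end HasTopCoeff

/-- The constant term vanishes in the limit; divide by `ε` and induct. This makes the coefficient in
`HasTopCoeff` unique. -/
theorem eq_zero_of_isLittleO_pow (n : ℕ) : ∀ P : Polynomial 𝕜, P.natDegree ≤ n →
    (fun ε => P.eval ε) =o[𝓝[≠] (0 : 𝕜)] (fun ε => ε ^ n) → P = 0 := by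
  have h0 : ∀ (m : ℕ) (P : Polynomial 𝕜),
      (fun ε => P.eval ε) =o[𝓝[≠] (0 : 𝕜)] (fun ε => ε ^ m) → P.eval 0 = 0 := by
    intro m P h
    have h1 : Tendsto (fun ε => P.eval ε) (𝓝[≠] (0 : 𝕜)) (𝓝 (P.eval 0)) :=
      (P.continuous.tendsto 0).mono_left nhdsWithin_le_nhds
    have h2 : (fun ε : 𝕜 => ε ^ m) =O[𝓝[≠] 0] (fun _ => (1 : 𝕜)) :=
      (((continuous_pow m).tendsto (0 : 𝕜)).mono_left nhdsWithin_le_nhds).isBigO_one 𝕜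
    exact tendsto_nhds_unique h1 ((Asymptotics.isLittleO_one_iff 𝕜).1 (h.trans_isBigO h2))
  induction n with
  | zero =>
    intro P hP h
    have := h0 0 P h
    rw [Polynomial.eq_C_of_natDegree_le_zero hP] at this ⊢
    simpa using this
  | succ n ih =>
    intro P hP h
    have hP0 := h0 _ P h
    rw [← Polynomial.coeff_zero_eq_eval_zero] at hP0
    have hX : P = Polynomial.X * P.divX := by
      conv_lhs => rw [← Polynomial.X_mul_divX_add P, hP0, map_zero, add_zero]
    have hdiv : P.divX = 0 := by
      refine ih _ (by rw [Polynomial.natDegree_divX_eq_natDegree_tsub_one]; omega) ?_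
      have h1 := (Asymptotics.isBigO_refl (fun ε : 𝕜 => ε⁻¹) (𝓝[≠] 0)).mul_isLittleO h
      refine h1.congr' ?_ ?_
      · filter_upwards [self_mem_nhdsWithin] with ε hε
        have hε : ε ≠ 0 := hε
        conv_lhs => rw [hX]
        simp [hε]
      · filter_upwards [self_mem_nhdsWithin] with ε hε
        have hε : ε ≠ 0 := hε
        rw [pow_succ']
        field_simp
    rw [hX, hdiv, mul_zero]

theorem HasTopCoeff.eq_of_tendsto {f h : 𝕜 → 𝕜} {n : ℕ} {c L : 𝕜} (hf : HasTopCoeff f n c)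
    (hfh : ∀ᶠ ε in 𝓝[≠] 0, f ε = ε ^ n * h ε) (hL : Tendsto h (𝓝[≠] 0) (𝓝 L)) : c = L := by
  obtain ⟨P, hP, rfl, h1⟩ := hf
  have h2 : (fun ε => h ε - L) =o[𝓝[≠] (0 : 𝕜)] (fun _ => (1 : 𝕜)) :=
    (Asymptotics.isLittleO_one_iff 𝕜).2 (by simpa using hL.sub_const L)
  have h3 := (Asymptotics.isBigO_refl (fun ε : 𝕜 => ε ^ n) (𝓝[≠] 0)).mul_isLittleO h2
  simp only [mul_one] at h3
  have h4 := h3.sub h1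
  have h5 := eq_zero_of_isLittleO_pow n (P - Polynomial.C L * Polynomial.X ^ n)
    ((Polynomial.natDegree_sub_le _ _).trans
      (max_le hP (Polynomial.natDegree_C_mul_X_pow_le _ _))) (h4.congr' (by
        filter_upwards [hfh] with ε hε
        rw [hε]
        simp only [Polynomial.eval_sub, Polynomial.eval_mul, Polynomial.eval_C,
          Polynomial.eval_pow, Polynomial.eval_X]
        ring) .rfl)
  have := congrArg (fun Q => Polynomial.coeff Q n) h5
  simpa [sub_eq_zero] using this

/-- The mean value inequality on the convex ball of radius `‖ε‖` replaces integration and treats the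
real and complex cases alike. -/
theorem isLittleO_pow_succ_of_hasDerivAt {f f' : 𝕜 → 𝕜} {n : ℕ}
    (hf : ∀ᶠ ε in 𝓝 (0 : 𝕜), HasDerivAt f (f' ε) ε) (h0 : f 0 = 0)
    (hf' : f' =o[𝓝 0] fun ε => ε ^ n) : f =o[𝓝 0] fun ε => ε ^ (n + 1) := by
  rw [Asymptotics.isLittleO_iff] at hf' ⊢
  intro c hc
  obtain ⟨r, hr, hball⟩ := Metric.eventually_nhds_iff_ball.1 (hf.and (hf' hc))
  filter_upwards [Metric.ball_mem_nhds 0 hr] with ε hε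
  have hsub : Metric.closedBall (0 : 𝕜) ‖ε‖ ⊆ Metric.ball 0 r :=
    Metric.closedBall_subset_ball (by simpa using hε)
  have := (convex_closedBall (0 : 𝕜) ‖ε‖).norm_image_sub_le_of_norm_hasDerivWithin_le
    (f := f) (f' := f') (C := c * ‖ε‖ ^ n) (x := 0) (y := ε)
    (fun z hz => (hball z (hsub hz)).1.hasDerivWithinAt)
    (fun z hz => ((hball z (hsub hz)).2).trans (by
      rw [norm_pow]
      have : ‖z‖ ≤ ‖ε‖ := by simpa using hz
      gcongr)) (by simp) (by simp)
  rw [h0, sub_zero, sub_zero] at this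
  rw [norm_pow, pow_succ, ← mul_assoc]
  exact this

theorem iterPartial_append (l l' : List (Fin N)) (f : (Fin N → 𝕜) → 𝕜) :
    iterPartial (l ++ l') f = iterPartial l (iterPartial l' f) := by
  induction l with
  | nil => rfl
  | cons k l ih => simp only [List.cons_append, iterPartial, ih]

/-- Taylor's formula in the direction of a coordinate. -/
theorem taylor_isLittleO_single (k : Fin N) (m : ℕ) :
    ∀ {f : (Fin N → 𝕜) → 𝕜} {x : Fin N → 𝕜}, ContDiffAt 𝕜 m f x →
      (fun ε : 𝕜 => f (x + ε • Pi.single k 1) -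
        ∑ r ∈ range (m + 1), iterPartial (List.replicate r k) f x / r.factorial * ε ^ r)
        =o[𝓝 0] fun ε => ε ^ m := by
  have hline : ∀ x : Fin N → 𝕜,
      Tendsto (fun ε : 𝕜 => x + ε • (Pi.single k 1 : Fin N → 𝕜)) (𝓝 0) (𝓝 x) := by
    intro x
    have : Continuous fun ε : 𝕜 => x + ε • (Pi.single k 1 : Fin N → 𝕜) := by fun_prop
    simpa using this.tendsto 0
  induction m with
  | zero =>
    intro f x hf
    simp only [pow_zero, Asymptotics.isLittleO_one_iff]
    have := (hf.continuousAt.tendsto.comp (hline x)).sub_const (f x)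
    simpa [iterPartial] using this
  | succ m ih =>
    intro f x hf
    refine isLittleO_pow_succ_of_hasDerivAt ?_ ?_ (ih (contDiffAt_firstPartial k hf))
    · filter_upwards [(hline x).eventually (eventually_contDiffAt hf)] with ε hε
      have h1 : HasDerivAt (fun ε : 𝕜 => x + ε • (Pi.single k 1 : Fin N → 𝕜))
          (Pi.single k 1) ε := by
        simpa using ((hasDerivAt_id ε).smul_const (Pi.single k 1 : Fin N → 𝕜)).const_add x
      have h2 := (hε.differentiableAt (by simp)).hasFDerivAt.comp_hasDerivAt ε h1
      have h3 : HasDerivAt (fun ε : 𝕜 =>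
          ∑ r ∈ range (m + 1 + 1), iterPartial (List.replicate r k) f x / r.factorial * ε ^ r)
          (∑ r ∈ range (m + 1), iterPartial (List.replicate r k)
            (fun z => firstPartial k f z) x / r.factorial * ε ^ r) ε := by
        have := HasDerivAt.fun_sum (u := range (m + 1 + 1)) fun r _ =>
          (hasDerivAt_pow r ε).const_mul (iterPartial (List.replicate r k) f x / r.factorial)
        refine this.congr_deriv ?_
        rw [Finset.sum_range_succ']
        simp only [Nat.cast_zero, zero_mul, mul_zero, add_zero]
        refine Finset.sum_congr rfl fun r _ => ?_
        have e : iterPartial (List.replicate (r + 1) k) f =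
            iterPartial (List.replicate r k) (fun z => firstPartial k f z) := by
          rw [List.replicate_succ', iterPartial_append]
          rfl
        have e1 : (r.factorial : 𝕜) ≠ 0 := by exact_mod_cast Nat.factorial_ne_zero r
        have e2 : (r : 𝕜) + 1 ≠ 0 := by exact_mod_cast Nat.succ_ne_zero r
        rw [e, Nat.factorial_succ, Nat.add_sub_cancel]
        push_cast
        field_simp
      exact h2.sub h3
    · rw [Finset.sum_range_succ']
      simp [iterPartial]

theorem hasTopCoeff_single (k : Fin N) {m : ℕ} {f : (Fin N → 𝕜) → 𝕜} {x : Fin N → 𝕜}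
    (hf : ContDiffAt 𝕜 m f x) :
    HasTopCoeff (fun ε : 𝕜 => f (x + ε • Pi.single k 1)) m
      (iterPartial (List.replicate m k) f x / m.factorial) := by
  refine ⟨∑ r ∈ range (m + 1), Polynomial.C (iterPartial (List.replicate r k) f x / r.factorial) *
    Polynomial.X ^ r, ?_, ?_, ?_⟩
  · refine Polynomial.natDegree_sum_le_of_forall_le _ _ fun r hr => ?_
    exact (Polynomial.natDegree_C_mul_X_pow_le _ _).trans
      (Nat.lt_succ_iff.1 (Finset.mem_range.1 hr))
  · simp [Polynomial.coeff_X_pow]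
  · refine ((taylor_isLittleO_single k m hf).mono nhdsWithin_le_nhds).congr_left fun ε => ?_
    simp [Polynomial.eval_finsetSum]

/-! ### The limit of `D_J φ` where all coordinates in `J` coincide. -/

/-- Limits along `distinctOn` are therefore unique: moving from `w` in the direction `(0, 1, …, N -
1)` separates all coordinates for small nonzero `ε`. -/
theorem neBot_nhdsWithin_distinctOn (I : Finset (Fin N)) (w : Fin N → 𝕜) :
    (𝓝[distinctOn 𝕜 I] w).NeBot := by
  let v : Fin N → 𝕜 := fun i => ((i : ℕ) : 𝕜)
  have ht : Tendsto (fun ε : 𝕜 => w + ε • v) (𝓝[≠] 0) (𝓝[distinctOn 𝕜 I] w) := by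
    have hc : Continuous fun ε : 𝕜 => w + ε • v := by fun_prop
    refine tendsto_nhdsWithin_iff.2 ⟨?_, ?_⟩
    · simpa using (hc.tendsto 0).mono_left (nhdsWithin_le_nhds (s := {0}ᶜ))
    · have hpair : ∀ i j : Fin N, ∀ᶠ ε : 𝕜 in 𝓝[≠] 0,
          (w + ε • v) i = (w + ε • v) j → i = j := by
        intro i j
        by_cases hij : i = j
        · exact .of_forall fun _ _ => hij
        by_cases hw : w i = w j
        · filter_upwards [self_mem_nhdsWithin] with ε hε h
          have hε : ε ≠ 0 := hε
          simp only [Pi.add_apply, Pi.smul_apply, smul_eq_mul, hw, add_right_inj,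
            mul_right_inj' hε, v] at h
          exact Fin.ext (by exact_mod_cast h)
        · have h1 : ContinuousAt (fun ε : 𝕜 => (w + ε • v) i - (w + ε • v) j) 0 := by
            fun_prop
          have h2 := h1.eventually_ne (y := 0) (by simpa [sub_eq_zero] using hw)
          filter_upwards [nhdsWithin_le_nhds h2] with ε hε h
          exact absurd (sub_eq_zero.2 h) hε
      have := eventually_all.2 fun i => eventually_all.2 fun j => hpair i j
      filter_upwards [this] with ε hε
      exact fun i _ j _ h => hε i j h
  exact ht.neBot

theorem IsSymmetricFun.partialPartition_eq_iterPartial {φ : (Fin N → 𝕜) → 𝕜}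
    (hφ : IsSymmetricFun φ) {J : Finset (Fin N)} {x : Fin N → 𝕜} {y : 𝕜}
    (hJ : ∀ i ∈ J, x i = y) {g : ℕ} (hg : ContDiffAt 𝕜 g φ x) {σ : g.Partition}
    {l : List (Fin N)} (hlen : l.length = g) (hl : ∀ j ∈ l, j ∈ J)
    (hσ : l.toFinset.val.map l.count = σ.parts) :
    partialPartition J σ φ x = iterPartial l φ x := by
  subst hlen
  have himg : univ.image l.get = l.toFinset := by
    ext j
    simp [List.mem_iff_get]
  have hi : IsAssignment J σ l.get := by
    refine ⟨fun q => hl _ (l.get_mem q), ?_⟩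
    rw [himg, ← hσ]
    refine Multiset.map_congr rfl fun j _ => ?_
    rw [← count_ofFn, List.ofFn_get]
  rw [hφ.partialPartition_eq hJ hg hi, mixedPartial_eq_iterPartial _ hg, List.ofFn_get]

open Classical in
/-- The derivative `∂_J^s φ` for a multiset `s` of positive integers. -/
def multisetPartial (J : Finset (Fin N)) (φ : (Fin N → 𝕜) → 𝕜) (x : Fin N → 𝕜)
    (s : Multiset ℕ) : 𝕜 :=
  if h : ∀ i ∈ s, 0 < i then partialPartition J ⟨s, fun {i} hi => h i hi, rfl⟩ φ x else 0

/-- Indexing by multisets puts partitions of different integers into one type, as `sum_newtonCoeff`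
requires. -/
theorem multisetPartial_parts (J : Finset (Fin N)) (φ : (Fin N → 𝕜) → 𝕜) (x : Fin N → 𝕜)
    {g : ℕ} (σ : g.Partition) :
    multisetPartial J φ x σ.parts = partialPartition J σ φ x := by
  obtain ⟨s, hs, rfl⟩ := σ
  exact dif_pos fun i hi => hs hi

theorem partialTotal_eq_sum_multisetPartial (J : Finset (Fin N)) (g : ℕ) (φ : (Fin N → 𝕜) → 𝕜)
    (x : Fin N → 𝕜) :
    partialTotal J g φ x =
      ∑ σ : g.Partition, newtonCoeff 𝕜 σ.parts * multisetPartial J φ x σ.parts := by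
  simp only [partialTotal_eq, multisetPartial_parts]

/-- Differentiating `h` more times with respect to a further variable. -/
theorem IsSymmetricFun.iterPartial_replicate_append {φ : (Fin N → 𝕜) → 𝕜}
    (hφ : IsSymmetricFun φ) {J : Finset (Fin N)} {x : Fin N → 𝕜} {y : 𝕜}
    (hJ : ∀ i ∈ J, x i = y) {k : Fin N} (hk : k ∈ J) {a h : ℕ} (hh : 0 < h)
    (hg : ContDiffAt 𝕜 (h + a : ℕ) φ x) {τ : a.Partition} {i : Fin a → Fin N}
    (hi : IsAssignment (J.erase k) τ i) :
    iterPartial (List.replicate h k ++ List.ofFn i) φ x =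
      multisetPartial J φ x (h ::ₘ τ.parts) := by
  let σ : (h + a).Partition := ⟨h ::ₘ τ.parts, fun {j} hj => by
    rcases Multiset.mem_cons.1 hj with rfl | hj
    · exact hh
    · exact τ.parts_pos hj, by rw [Multiset.sum_cons, τ.parts_sum]⟩
  have hkimg : k ∉ univ.image i := by
    intro hk'
    obtain ⟨q, -, hq⟩ := Finset.mem_image.1 hk'
    exact Finset.notMem_erase k J (hq ▸ hi.1 q)
  have hknot : k ∉ List.ofFn i := by
    intro hk'
    obtain ⟨q, hq⟩ := (List.mem_ofFn' i k).1 hk'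
    exact hkimg (Finset.mem_image.2 ⟨q, mem_univ _, hq⟩)
  have hset : (List.replicate h k ++ List.ofFn i).toFinset = insert k (univ.image i) := by
    ext j
    simp [List.mem_replicate, hh.ne', List.mem_ofFn', eq_comm]
  rw [← hφ.partialPartition_eq_iterPartial hJ hg (σ := σ) (by simp) ?_ ?_,
    ← multisetPartial_parts]
  · intro j hj
    rcases List.mem_append.1 hj with hj | hj
    · rwa [List.eq_of_mem_replicate hj]
    · obtain ⟨q, rfl⟩ := (List.mem_ofFn' i j).1 hj
      exact Finset.mem_of_mem_erase (hi.1 q)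
  · rw [hset, Finset.insert_val_of_notMem hkimg, Multiset.map_cons]
    change _ = h ::ₘ τ.parts
    rw [← hi.2, List.count_append, List.count_replicate_self,
      List.count_eq_zero_of_not_mem hknot, add_zero]
    congr 1
    refine Multiset.map_congr rfl fun j hj => ?_
    have hjk : k ≠ j := fun h => hkimg (h ▸ hj)
    rw [List.count_append, count_ofFn, List.count_replicate]
    simp [hjk]

/-- The assignments chosen in `partialTotal` do not depend on the point, so each summand is a fixed
derivative of class `C^h` restricted to a line. Its Taylor coefficient of order `h` adds the part
`h`, carried by the new index `k`. -/
theorem IsSymmetricFun.hasTopCoeff_partialTotal {φ : (Fin N → 𝕜) → 𝕜}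
    (hφ : IsSymmetricFun φ) {J : Finset (Fin N)} {x : Fin N → 𝕜} {y : 𝕜}
    (hJ : ∀ i ∈ J, x i = y) {k : Fin N} (hk : k ∈ J) {a h : ℕ} (hh : 0 < h)
    (hg : ContDiffAt 𝕜 (h + a : ℕ) φ x) (ha : a ≤ #(J.erase k)) :
    HasTopCoeff (fun ε : 𝕜 => partialTotal (J.erase k) a φ (x + ε • Pi.single k 1)) h
      (∑ τ : a.Partition, newtonCoeff 𝕜 τ.parts *
        (multisetPartial J φ x (h ::ₘ τ.parts) / h.factorial)) := by
  simp only [partialTotal_eq]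
  refine HasTopCoeff.sum fun τ _ => HasTopCoeff.const_mul _ ?_
  have hex := exists_isAssignment (J.erase k) τ ((card_parts_le τ).trans ha)
  have hi := hex.choose_spec
  have hline : Tendsto (fun ε : 𝕜 => x + ε • (Pi.single k 1 : Fin N → 𝕜)) (𝓝 0) (𝓝 x) := by
    have : Continuous fun ε : 𝕜 => x + ε • (Pi.single k 1 : Fin N → 𝕜) := by fun_prop
    simpa using this.tendsto 0
  rw [← hφ.iterPartial_replicate_append hJ hk hh hg hi, iterPartial_append]
  refine (hasTopCoeff_single k (contDiffAt_iterPartial (List.ofFn hex.choose)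
    (by simpa using hg))).congr' ?_
  filter_upwards [nhdsWithin_le_nhds (hline.eventually (eventually_contDiffAt hg))] with ε hε
  rw [partialPartition, dif_pos hex, mixedPartial_eq_iterPartial _ (hε.of_le (by simp))]

/-- The limit of `D_J φ` at a point at which all the coordinates with indices in `J` coincide. -/
theorem IsSymmetricFun.tendsto_diffOp {φ : (Fin N → 𝕜) → 𝕜} (hφ : IsSymmetricFun φ) (p : ℕ) :
    ∀ (J : Finset (Fin N)), #J = p → 0 < p → ∀ (x : Fin N → 𝕜) (y : 𝕜), (∀ i ∈ J, x i = y) →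
      ContDiffAt 𝕜 p φ x →
      Tendsto (diffOp J φ) (𝓝[distinctOn 𝕜 J] x) (𝓝 (partialTotal J p φ x)) := by
  induction p using Nat.strong_induction_on with
  | _ p ih =>
  intro J hJp hp x y hJ hg
  obtain ⟨n, rfl⟩ : ∃ n, p = n + 1 := ⟨p - 1, by omega⟩
  obtain ⟨k, hk⟩ : J.Nonempty := Finset.card_pos.1 (by omega)
  have hcard : #(J.erase k) = n := by rw [Finset.card_erase_of_mem hk, hJp]; rfl
  -- Class `C^p` is just enough for a continuous extension, which gives the existence of the limit;
  -- only its value `G x` remains to be found.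
  obtain ⟨G, hG, hGD⟩ := hφ.exists_extension n J hJp hJ 0 (by simpa using hg)
  have hlim : Tendsto (diffOp J φ) (𝓝[distinctOn 𝕜 J] x) (𝓝 (G x)) :=
    (hG.continuousAt.tendsto.mono_left nhdsWithin_le_nhds).congr' (by
      filter_upwards [hGD] with z hz using hz.symm)
  suffices hL : partialTotal J (n + 1) φ x = G x by rwa [hL]
  have hline : Tendsto (fun ε : 𝕜 => x + ε • (Pi.single k 1 : Fin N → 𝕜)) (𝓝 0) (𝓝 x) := by
    have : Continuous fun ε : 𝕜 => x + ε • (Pi.single k 1 : Fin N → 𝕜) := by fun_prop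
    simpa using this.tendsto 0
  have hGw : ∀ᶠ w in 𝓝 x, Tendsto (diffOp J φ) (𝓝[distinctOn 𝕜 J] w) (𝓝 (G w)) := by
    rw [eventually_nhdsWithin_iff] at hGD
    filter_upwards [eventually_contDiffAt hG, hGD.eventually_nhds] with w hw1 hw2
    refine (hw1.continuousAt.tendsto.mono_left nhdsWithin_le_nhds).congr' ?_
    rw [EventuallyEq, eventually_nhdsWithin_iff]
    filter_upwards [hw2] with z hz hzJ using (hz hzJ).symm
  -- At `w` only the coordinates in `J.erase k` coincide, so the induction hypothesis and
  -- `tendsto_diffOp_union` with `K = {k}` compute `G w`. The formula is multiplied by `(-1)^n ε^n`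
  -- to clear the denominators.
  have hval : ∀ᶠ ε : 𝕜 in 𝓝[≠] 0,
      firstPartial k φ (x + ε • Pi.single k 1) + ∑ a ∈ Icc 1 n, (-1) ^ a *
        (ε ^ (a - 1) * partialTotal (J.erase k) a φ (x + ε • Pi.single k 1)) =
      ε ^ n * ((-1) ^ n * G (x + ε • Pi.single k 1)) := by
    filter_upwards [nhdsWithin_le_nhds (hline.eventually hGw),
      nhdsWithin_le_nhds (hline.eventually (eventually_contDiffAt hg)), self_mem_nhdsWithin]
      with ε h1 h2 hε
    have hε : ε ≠ 0 := hε
    set w : Fin N → 𝕜 := x + ε • Pi.single k 1 with hw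
    have hwk : w k = y + ε := by simp [hw, hJ k hk]
    have hwJ : ∀ i ∈ J.erase k, w i = y := by
      intro i hi
      rw [Finset.mem_erase] at hi
      simp [hw, hJ i hi.2, hi.1]
    have hlimw := tendsto_diffOp_union (y := y) (c := fun a => partialTotal (J.erase k) a φ w)
      (h2.of_le (by exact_mod_cast Nat.le_add_left 1 n)) hwJ (fun J' hJ' hne => by
        have hle : #J' ≤ n := hcard ▸ Finset.card_le_card hJ'
        have hC := h2.of_le (m := (#J' : ℕ)) (by exact_mod_cast hle.trans (Nat.le_succ n))
        rw [← hφ.partialTotal_subset hJ' hwJ hC le_rfl]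
        exact ih #J' (Nat.lt_succ_of_le hle) J' rfl hne.card_pos w y
          (fun i hi => hwJ i (hJ' hi)) hC) _ (J.erase k) {k} subset_rfl rfl
      (by simpa [hwk] using hε) (by simp [distinctOn])
    have hJk : J.erase k ∪ {k} = J := by
      rw [Finset.union_comm, ← Finset.insert_eq, Finset.insert_erase hk]
    rw [hJk, hcard] at hlimw
    have := neBot_nhdsWithin_distinctOn J w
    rw [tendsto_nhds_unique h1 hlimw, confluentValue, Finset.sum_singleton, hwk, mul_add,
      mul_add, Finset.mul_sum, Finset.mul_sum]
    have hy : y - (y + ε) = -ε := by ring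
    congr 1
    · have : ((-1 : 𝕜) ^ n) ≠ 0 := pow_ne_zero _ (by simp)
      rw [hy, neg_pow ε, Finset.erase_singleton, Finset.prod_empty, mul_one]
      field_simp
    · refine Finset.sum_congr rfl fun a ha => ?_
      obtain ⟨ha1, ha2⟩ := Finset.mem_Icc.1 ha
      have hs : (-1 : 𝕜) ^ n * (-1) ^ (n - a) = (-1) ^ a := by
        rw [← pow_add, show n + (n - a) = a + 2 * (n - a) by omega, pow_add, pow_mul]
        simp
      have he : ε ^ n = ε ^ (a - 1) * ε ^ (n - a + 1) := by
        rw [← pow_add]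
        congr 1
        omega
      rw [kernelSeries, Finset.prod_singleton, PowerSeries.coeff_mk, hwk, add_sub_cancel_left, he,
        ← hs]
      field_simp
  -- After the factor `ε^(a-1)`, the order `n + 1 - a` is needed from `∂_{J \ k}^a φ`, exactly the
  -- smoothness left after `a` derivatives.
  have htop : HasTopCoeff (fun ε : 𝕜 =>
      firstPartial k φ (x + ε • Pi.single k 1) + ∑ a ∈ Icc 1 n, (-1) ^ a *
        (ε ^ (a - 1) * partialTotal (J.erase k) a φ (x + ε • Pi.single k 1))) n
      (multisetPartial J φ x {n + 1} / n.factorial + ∑ a ∈ Icc 1 n, (-1) ^ a *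
        ∑ τ : a.Partition, newtonCoeff 𝕜 τ.parts *
          (multisetPartial J φ x ((n + 1 - a) ::ₘ τ.parts) / (n + 1 - a).factorial)) := by
    refine HasTopCoeff.add ?_ (HasTopCoeff.sum fun a ha => HasTopCoeff.const_mul _ ?_)
    · have h1 := hasTopCoeff_single k (contDiffAt_firstPartial k hg)
      -- The pure derivative `∂_k^(n+1)` is the case of the empty partition, with `n + 1` as the
      -- only part.
      have h2 := hφ.iterPartial_replicate_append hJ hk (a := 0) (h := n + 1) (by omega) hg
        (τ := default) (i := Fin.elim0) ⟨fun q => q.elim0, by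
          simp⟩
      convert h1 using 2
      rw [List.ofFn_zero, List.append_nil, List.replicate_succ', iterPartial_append] at h2
      rw [show ({n + 1} : Multiset ℕ) = (n + 1) ::ₘ (default : Nat.Partition 0).parts by simp,
        ← h2]
      rfl
    · obtain ⟨ha1, ha2⟩ := Finset.mem_Icc.1 ha
      have h1 := (hφ.hasTopCoeff_partialTotal hJ hk (a := a) (h := n + 1 - a) (by omega)
        (by convert hg using 2; omega) (by omega)).pow_mul (a - 1)
      rwa [show a - 1 + (n + 1 - a) = n by omega] at h1
  have hGlim : Tendsto (fun ε : 𝕜 => (-1 : 𝕜) ^ n * G (x + ε • Pi.single k 1)) (𝓝[≠] 0)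
      (𝓝 ((-1) ^ n * G x)) :=
    ((hG.continuousAt.tendsto.comp hline).mono_left nhdsWithin_le_nhds).const_mul _
  have hfin := htop.eq_of_tendsto hval hGlim
  have hsq : (-1 : 𝕜) ^ n * (-1) ^ n = 1 := by rw [← mul_pow]; simp
  have hGx : G x = (-1) ^ n * ((-1) ^ n * G x) := by rw [← mul_assoc, hsq, one_mul]
  rw [partialTotal_eq_sum_multisetPartial, sum_newtonCoeff, hGx, ← hfin, mul_add, Finset.mul_sum]
  congr 1
  · ring
  · refine Finset.sum_congr rfl fun a ha => ?_
    obtain ⟨ha1, ha2⟩ := Finset.mem_Icc.1 ha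
    have hs : (-1 : 𝕜) ^ (n - a) = (-1) ^ n * (-1) ^ a := by
      rw [← pow_add, show n + a = (n - a) + 2 * a by omega, pow_add, pow_mul]
      simp
    rw [Finset.mul_sum, Finset.mul_sum]
    refine Finset.sum_congr rfl fun τ _ => ?_
    rw [hs]
    ring

end

end SymmDeriv

/-! ### The theorem. -/

theorem theorem3p2 {𝕜 : Type*} [RCLike 𝕜] {N : ℕ} (φ : (Fin N → 𝕜) → 𝕜)
    (hsymm : SymmDeriv.IsSymmetricFun φ)
    (I J : Finset (Fin N)) (hJI : J ⊆ I) (p : ℕ) (hp : J.card = p) (hp1 : 1 ≤ p)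
    (x : Fin N → 𝕜) (y : 𝕜) (hJ : ∀ i ∈ J, x i = y) (hy : ∀ k ∈ I \ J, x k ≠ y)
    (hinj : ∀ k ∈ I \ J, ∀ l ∈ I \ J, k ≠ l → x k ≠ x l)
    (hφ : ContDiffAt 𝕜 p φ x) :
    (∀ g : ℕ, 1 ≤ g → g ≤ p → ∀ (σ : g.Partition) (i : Fin g → Fin N),
      SymmDeriv.IsAssignment J σ i →
        SymmDeriv.mixedPartial i φ x = SymmDeriv.partialPartition J σ φ x) ∧
    Tendsto (SymmDeriv.diffOp I φ) (𝓝[SymmDeriv.distinctOn 𝕜 I] x)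
      (𝓝 ((∑ k ∈ I \ J, SymmDeriv.firstPartial k φ x /
            ((y - x k) ^ p * ∏ l ∈ I \ (J ∪ {k}), (x l - x k))) +
          ∑ q ∈ SymmDeriv.indexSet (I \ J) (p - 1),
            (-1 : 𝕜) ^ (p - q.1) * SymmDeriv.partialTotal J q.1 φ x /
              ∏ k : ↥(I \ J), (x k - y) ^ q.2 k)) := by
  have hle : ∀ {g : ℕ}, g ≤ p → ContDiffAt 𝕜 g φ x := fun hg => hφ.of_le (by exact_mod_cast hg)
  refine ⟨fun g _ hg σ i hi => (hsymm.partialPartition_eq hJ (hle hg) hi).symm, ?_⟩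
  have hlim := SymmDeriv.tendsto_diffOp_union (y := y)
    (c := fun a => SymmDeriv.partialTotal J a φ x) (by exact_mod_cast hle hp1) hJ
    (fun J' hJ' hne => by
      -- The limit for each `J' ⊆ J` is rewritten with derivatives over `J`, so that it depends on
      -- `#J'` alone.
      have hC := hle (hp ▸ Finset.card_le_card hJ')
      rw [← hsymm.partialTotal_subset hJ' hJ hC le_rfl]
      exact hsymm.tendsto_diffOp #J' J' rfl hne.card_pos x y (fun i hi => hJ i (hJ' hi)) hC)
    _ J (I \ J) subset_rfl rfl hy
    (fun k hk l hl h => by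
      by_contra hne
      exact hinj k hk l hl hne h)
  rw [Finset.union_sdiff_of_subset hJI, hp, SymmDeriv.confluentValue,
    ← SymmDeriv.sum_indexSet hp1] at hlim
  have herase : ∀ k, I \ (J ∪ {k}) = (I \ J).erase k := by
    intro k
    ext l
    simp only [Finset.mem_sdiff, Finset.mem_union, Finset.mem_singleton, Finset.mem_erase]
    tauto
  simp only [herase]
  exact hlim
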